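/- Let $S_{b_2}$ be the set of permutations $\pi$ of $\{1,\dots,n\}$ with $\pi(i)\ge i-1$ for $2\le i\le n$, and let $\pi$ be uniformly distributed on $S_{b_2}$. Fix an integer $k\ge 1$. For $n\ge k$, let $C_{n,k}$ be the number of $k$-cycles of $\pi$ (fixed points being the $1$-cycles), $\sigma_{n,k}^2=\mathrm{Var}(C_{n,k})$, and for $1\le i\le n-k+1$ let $I_i$ be the indicator of the event that $(i\;\, i+k-1\;\, i+k-2\;\cdots\; i+1)$ is a cycle of $\pi$. Put $X_i=I_i-\mathbb{E}I_i$, $$W=\frac1{\sigma_{n,k}}\sum_{i=1}^{n-k+1}X_i,\qquad a_{n,k}=\sum_{i=1}^{n-k+1}\mathbb{E}|X_i|^3,\qquad b_{n,k}=\sum_{i=1}^{n-k+1}\mathbb{E}[X_i^4].$$ Let $d_W(\mu,\nu)=\sup\{|\int h\,d\mu-\int h\,d\nu| : |h(x)-h(y)|\le|x-y| \text{ for all } x,y\in\mathbb{R}\}$ be the Wasserstein distance, and let $Z\sim N(0,1)$. (1) For all $n\ge 2$ with $n\ge k$ one has $\sigma_{n,k}>0$ and $$d_W(W,Z)\le \frac{4k^2}{\sigma_{n,k}^3}\,a_{n,k}+\frac{\sqrt{28}\,(2k)^{3/2}}{\sqrt{\pi}\,\sigma_{n,k}^2}\sqrt{b_{n,k}}.$$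 (2) For all $n>k$: $\mathbb{E}I_i=2^{-k}$ if $i\in\{1,n-k+1\}$ and $\mathbb{E}I_i=2^{-(k+1)}$ otherwise, $$a_{n,k}=2\,\frac{2^{3k}-3\cdot2^{2k}+2^{k+2}-2}{2^{4k}}+(n-k-1)\,\frac{2^{3(k+1)}-3\cdot2^{2(k+1)}+2^{k+3}-2}{2^{4(k+1)}},$$ $$b_{n,k}=2\,\frac{(2^{2k}-3\cdot2^{k}+3)(2^k-1)}{2^{4k}}+(n-k-1)\,\frac{(2^{2(k+1)}-3\cdot2^{k+1}+3)(2^{k+1}-1)}{2^{4(k+1)}}.$$ (3) For all $n>2k$: $$\sigma_{n,k}^2=\frac{(2^{k+1}-2k+3)n+3k(k-4)+(3-k)2^{k+1}+5}{4^{k+1}}.$$ (4) For fixed $k$, as $n\to\infty$, $\sigma_{n,k}^2=\Theta(n)$, $a_{n,k}=\Theta(n)$ and $b_{n,k}=\Theta(n)$, and the upper bound in (1) is $\Theta(n^{-1/2})$. -/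

import Mathlib

open MeasureTheory ProbabilityTheory Filter Asymptotics

/-- Every set of permutations of the finite set `Fin n` is an event. -/
instance permMeasurableSpace (n : ℕ) : MeasurableSpace (Equiv.Perm (Fin n)) := ⊤

/-- `π` is `b`-regular: `π(i) ≥ b_i` for all `i`. The numbers `1, …, n` are represented by
`Fin n = {0, …, n - 1}`, so the value of `π` at `i` in the usual labelling is `(π i : ℕ) + 1`. -/
def IsBRegular {n : ℕ} (b : Fin n → ℕ) (π : Equiv.Perm (Fin n)) : Prop :=
  ∀ i, b i ≤ (π i : ℕ) + 1

/-- The restriction vector `b₂ = [1, 1, 2, 3, …, n - 1]`. -/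
def b2 (n : ℕ) : Fin n → ℕ := fun i => max 1 (i : ℕ)

/-- The law of a uniformly random `b₂`-regular permutation of `n` letters. -/
noncomputable def unifB2 (n : ℕ) : Measure (Equiv.Perm (Fin n)) :=
  uniformOn {π | IsBRegular (b2 n) π}

/-- The number `C_{n,k}(π)` of `k`-cycles of `π`; fixed points are the `1`-cycles. -/
def numCycles {n : ℕ} (k : ℕ) (π : Equiv.Perm (Fin n)) : ℕ := π.partition.parts.count k

/-- The variance `σ²_{n,k}` of the number of `k`-cycles of a uniform `b₂`-regular permutation. -/
noncomputable def sigmaSq (n k : ℕ) : ℝ :=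
  variance (fun π : Equiv.Perm (Fin n) => (numCycles k π : ℝ)) (unifB2 n)

/-- The standard deviation `σ_{n,k}`. -/
noncomputable def sigma (n k : ℕ) : ℝ := √(sigmaSq n k)

/-- One of the potential `k`-cycles is a cycle of `π`: the one on the consecutive letters
`i, i + 1, …, i + k - 1`, namely `(i  i+k-1  i+k-2  …  i+1)` in cycle notation.
It is used for `1 ≤ k` and `i + k ≤ n` only. -/
def HasCycleAt {n : ℕ} (k i : ℕ) (π : Equiv.Perm (Fin n)) : Prop :=
  (∀ x : Fin n, (x : ℕ) = i → (π x : ℕ) + 1 = i + k) ∧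
    ∀ x : Fin n, i < (x : ℕ) → (x : ℕ) < i + k → (π x : ℕ) + 1 = (x : ℕ)

/-- The indicator of the potential `k`-cycle that starts at `i` (`i = 0, …, n - k`). -/
noncomputable def cycInd (n k i : ℕ) : Equiv.Perm (Fin n) → ℝ :=
  Set.indicator {π | HasCycleAt k i π} (fun _ => 1)

/-- The shifted (centred) indicator `X_i`. -/
noncomputable def X (n k i : ℕ) (π : Equiv.Perm (Fin n)) : ℝ :=
  cycInd n k i π - ∫ ρ, cycInd n k i ρ ∂(unifB2 n)

/-- `W = (1 / σ) ∑ X_i`. -/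
noncomputable def W (n k : ℕ) (π : Equiv.Perm (Fin n)) : ℝ :=
  1 / sigma n k * ∑ i ∈ Finset.range (n - k + 1), X n k i π

/-- `a_{n,k} = ∑ E|X_i|³`. -/
noncomputable def aSum (n k : ℕ) : ℝ :=
  ∑ i ∈ Finset.range (n - k + 1), ∫ π, |X n k i π| ^ 3 ∂(unifB2 n)

/-- `b_{n,k} = ∑ E[X_i⁴]`. -/
noncomputable def bSum (n k : ℕ) : ℝ :=
  ∑ i ∈ Finset.range (n - k + 1), ∫ π, X n k i π ^ 4 ∂(unifB2 n)

/-- The Wasserstein distance of two probability measures on `ℝ` with finite first moment: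
the supremum of `|∫ h dμ - ∫ h dν|` over all `h : ℝ → ℝ` with `|h x - h y| ≤ |x - y|`. -/
noncomputable def wassersteinDist (μ ν : Measure ℝ) : ENNReal :=
  ⨆ (h : ℝ → ℝ) (_ : ∀ x y, |h x - h y| ≤ |x - y|),
    ENNReal.ofReal |∫ x, h x ∂μ - ∫ x, h x ∂ν|

/-- The upper bound for the Wasserstein distance from `W` to the standard normal law. -/
noncomputable def upperBound (n k : ℕ) : ℝ :=
  4 * (k : ℝ) ^ 2 / sigma n k ^ 3 * aSum n k +
    √28 * (2 * (k : ℝ)) ^ ((3 : ℝ) / 2) / (√Real.pi * sigma n k ^ 2) * √(bSum n k)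

/-!
The proof rests on a product structure and on Stein's method for locally dependent summands.

A `b₂`-regular permutation satisfies `π(j) ≥ j - 1`, and it is determined by the set of positions
`1 ≤ j < n` with `π(j) ≠ j - 1`, its cuts. Its cycles are the intervals between consecutive cuts,
and every set of cuts occurs (`bijOn_cutSet`). Hence under the uniform law the cuts are
independent fair coin tosses (`iIndepSet_isCut`, `indepFun_of_cuts`), and the number of `k`-cycles
is the number of pairs of consecutive cuts at distance `k` (`numCycles_eq_sum`). The indicator at
`i` is a function of the cuts in `[i, i + k]`: two of them exclude each other at distance less
than `k`, share one cut at distance `k`, and are independent beyond. All explicit formulas follow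
from this; the variance is summed along the diagonals of the covariance matrix
(`sigmaSq_formula`).

For the Wasserstein bound, let `f` be the solution of `f'(w) - w f(w) = h(w) - E h(Z)` for a
`1`-Lipschitz function `h`. Then `|f'| ≤ 1`, and `f'` is `2`-Lipschitz (`exists_stein_solution`).
For the second fact the key is that `w f(w)` is nonincreasing if `h` is nondecreasing
(`mul_le_tail_of_monotone`): applied to `x + h(x)` and `x - h(x)` it shows that `w f(w)` is
`1`-Lipschitz, so that no derivative of `h` is needed. With `S i = ∑_{|j - i| ≤ k} X j` one
obtains (`stein_local_dependence`)

  `d_W(W, Z) ≤ σ⁻³ ∑ E |X i| (S i)² + σ⁻² √((6 k + 1) ∑ E (X i S i)²)`.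

The neighbourhood of `i` has `2 k + 1` elements, and the products `X i S i` and `X j S j` are
dependent for up to `6 k + 1` indices `j`. In the second term the constant `28 / π` leaves enough
room for this (`sqrt_dependence_le`). In the first term, bounding all `(2 k + 1)²` products
separately is too crude to give the factor `4 k²`. But at most three `k`-cycles fit into a
neighbourhood, whence `|S i| ≤ 3 ≤ k` for `k ≥ 3`; the case `k = 2` uses the mean number of cycles
in the neighbourhood in addition, and for `k = 1` the sum is evaluated exactly
(`sum_integral_abs_mul_nbrSum_sq_le`), with equality for `n = 2`.
-/

/-! ### Mills ratio bounds and the Stein equation -/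

/-- The unnormalised standard Gaussian density `exp (-x² / 2)`. -/
noncomputable def gaussWeight (x : ℝ) : ℝ := Real.exp (-(x ^ 2 / 2))

lemma gaussWeight_pos (x : ℝ) : 0 < gaussWeight x := Real.exp_pos _

lemma gaussWeight_neg (x : ℝ) : gaussWeight (-x) = gaussWeight x := by
  simp [gaussWeight]

lemma exp_mul_gaussWeight (x : ℝ) : Real.exp (x ^ 2 / 2) * gaussWeight x = 1 := by
  rw [gaussWeight, ← Real.exp_add, add_neg_cancel, Real.exp_zero]

lemma continuous_gaussWeight : Continuous gaussWeight := by
  unfold gaussWeight; fun_prop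

lemma hasDerivAt_gaussWeight (x : ℝ) : HasDerivAt gaussWeight (-x * gaussWeight x) x := by
  have h : HasDerivAt (fun y : ℝ => -(y ^ 2 / 2)) (-x) x := by
    exact ((hasDerivAt_pow 2 x).div_const 2).neg.congr_deriv (by push_cast; ring)
  exact h.exp.congr_deriv (by rw [gaussWeight]; ring)

lemma integrable_gaussWeight : Integrable gaussWeight := by
  have := integrable_exp_neg_mul_sq (b := 1 / 2) (by norm_num)
  refine this.congr (ae_of_all _ fun x => ?_)
  simp only [gaussWeight]; congr 1; ring

lemma integrable_id_mul_gaussWeight : Integrable (fun x => x * gaussWeight x) := by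
  have := integrable_mul_exp_neg_mul_sq (b := 1 / 2) (by norm_num)
  refine this.congr (ae_of_all _ fun x => ?_)
  simp only [gaussWeight]; congr 2; ring

lemma tendsto_gaussWeight_atTop : Tendsto gaussWeight atTop (nhds 0) := by
  unfold gaussWeight
  refine Real.tendsto_exp_neg_atTop_nhds_zero.comp ?_
  exact (tendsto_pow_atTop (two_ne_zero)).atTop_div_const (by norm_num)

lemma integral_Ioi_id_mul_gaussWeight (w : ℝ) :
    ∫ x in Set.Ioi w, x * gaussWeight x = gaussWeight w := by
  have := integral_Ioi_of_hasDerivAt_of_tendsto' (a := w) (m := 0)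
    (f := fun x => -gaussWeight x) (f' := fun x => x * gaussWeight x)
    (fun x _ => (hasDerivAt_gaussWeight x).neg.congr_deriv (by ring))
    integrable_id_mul_gaussWeight.integrableOn (by simpa using tendsto_gaussWeight_atTop.neg)
  simpa using this

/-- A function `r` with `|x r(x) - r'(x)| ≤ 1` on `[w, ∞)` is a lower bound for the Mills ratio
at `w`: integrate `-(r φ)' = (x r - r') φ ≤ φ` over the tail. -/
lemma mul_gaussWeight_le_integral_Ioi {w : ℝ} {r r' : ℝ → ℝ} (hr' : Measurable r')
    (hr : Measurable r)
    (hd : ∀ x ∈ Set.Ici w, HasDerivAt r (r' x) x) (hb : ∀ x ∈ Set.Ici w, |r x| ≤ 1)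
    (hle : ∀ x ∈ Set.Ici w, |x * r x - r' x| ≤ 1) :
    r w * gaussWeight w ≤ ∫ x in Set.Ioi w, gaussWeight x := by
  have hint : IntegrableOn (fun x => (x * r x - r' x) * gaussWeight x) (Set.Ioi w) := by
    refine Integrable.mono' integrable_gaussWeight.integrableOn ?_ ?_
    · exact (((measurable_id.mul hr).sub hr').mul
        continuous_gaussWeight.measurable).aestronglyMeasurable
    · filter_upwards [self_mem_ae_restrict measurableSet_Ioi] with x hx
      rw [norm_mul, Real.norm_eq_abs, Real.norm_of_nonneg (gaussWeight_pos x).le]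
      exact mul_le_of_le_one_left (gaussWeight_pos x).le (hle x (Set.Ioi_subset_Ici_self hx))
  have hlim : Tendsto (fun x => -(r x * gaussWeight x)) atTop (nhds 0) := by
    refine squeeze_zero_norm' ?_ tendsto_gaussWeight_atTop
    filter_upwards [eventually_ge_atTop w] with x hx
    rw [norm_neg, norm_mul, Real.norm_eq_abs, Real.norm_of_nonneg (gaussWeight_pos x).le]
    exact mul_le_of_le_one_left (gaussWeight_pos x).le (hb x hx)
  have key := integral_Ioi_of_hasDerivAt_of_tendsto' (a := w) (m := 0)
    (f := fun x => -(r x * gaussWeight x)) (f' := fun x => (x * r x - r' x) * gaussWeight x)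
    (fun x hx => ((hd x hx).mul (hasDerivAt_gaussWeight x)).neg.congr_deriv (by ring)) hint hlim
  have hmono : ∫ x in Set.Ioi w, (x * r x - r' x) * gaussWeight x
      ≤ ∫ x in Set.Ioi w, gaussWeight x := by
    refine setIntegral_mono_on hint integrable_gaussWeight.integrableOn measurableSet_Ioi ?_
    intro x hx
    exact mul_le_of_le_one_left (gaussWeight_pos x).le
      (abs_le.1 (hle x (Set.Ioi_subset_Ici_self hx))).2
  rw [key] at hmono
  linarith

/-- The classical lower bound for the Mills ratio. -/
lemma mills_lower {w : ℝ} (hw : 0 ≤ w) :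
    w / (1 + w ^ 2) * gaussWeight w ≤ ∫ x in Set.Ioi w, gaussWeight x := by
  refine mul_gaussWeight_le_integral_Ioi (r := fun x => x / (1 + x ^ 2))
    (r' := fun x => (1 - x ^ 2) / (1 + x ^ 2) ^ 2) (by fun_prop) (by fun_prop) ?_ ?_ ?_
  · intro x _
    have h1 : HasDerivAt (fun y : ℝ => 1 + y ^ 2) (2 * x) x := by
      simpa using (hasDerivAt_pow 2 x).const_add 1
    exact ((hasDerivAt_id x).div h1 (by positivity)).congr_deriv (by simp only [id]; ring)
  · intro x hx
    have hx : 0 ≤ x := hw.trans hx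
    rw [abs_of_nonneg (by positivity), div_le_one (by positivity)]
    nlinarith [sq_nonneg (x - 1)]
  · intro x hx
    have : x * (x / (1 + x ^ 2)) - (1 - x ^ 2) / (1 + x ^ 2) ^ 2 = 1 - 2 / (1 + x ^ 2) ^ 2 := by
      field_simp; ring
    simp only [this]
    have h2 : 2 / (1 + x ^ 2) ^ 2 ≤ 2 := by
      rw [div_le_iff₀ (by positivity)]; nlinarith [sq_nonneg x, sq_nonneg (x ^ 2)]
    have h3 : 0 ≤ 2 / (1 + x ^ 2) ^ 2 := by positivity
    rw [abs_le]; constructor <;> linarith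

/-- A lower bound for the Mills ratio that is sharper than `w / (1 + w²)` for small `w`. It is what
keeps the derivative of the Stein solution below `1`. -/
lemma mills_lower' {w : ℝ} (hw : 0 ≤ w) :
    (2 + w) / (2 + 2 * w + w ^ 2) * gaussWeight w ≤ ∫ x in Set.Ioi w, gaussWeight x := by
  refine mul_gaussWeight_le_integral_Ioi (r := fun x => (2 + x) / (2 + 2 * x + x ^ 2))
    (r' := fun x => -(x ^ 2 + 4 * x + 2) / (2 + 2 * x + x ^ 2) ^ 2)
    (by fun_prop) (by fun_prop) ?_ ?_ ?_
  · intro x hx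
    have hx : 0 ≤ x := hw.trans hx
    have h1 : HasDerivAt (fun y : ℝ => 2 + 2 * y + y ^ 2) (2 + 2 * x) x := by
      exact ((((hasDerivAt_id x).const_mul 2).const_add 2).add (hasDerivAt_pow 2 x)).congr_deriv
        (by push_cast; ring)
    have h2 : HasDerivAt (fun y : ℝ => 2 + y) 1 x := (hasDerivAt_id x).const_add 2
    exact (h2.div h1 (by positivity)).congr_deriv (by ring)
  · intro x hx
    have hx : 0 ≤ x := hw.trans hx
    rw [abs_of_nonneg (by positivity), div_le_one (by positivity)]
    nlinarith
  · intro x hx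
    have hx : 0 ≤ x := hw.trans hx
    have hq : (2 + 2 * x + x ^ 2) ≠ 0 := by positivity
    have : x * ((2 + x) / (2 + 2 * x + x ^ 2)) - -(x ^ 2 + 4 * x + 2) / (2 + 2 * x + x ^ 2) ^ 2
        = 1 - (2 + x ^ 2) / (2 + 2 * x + x ^ 2) ^ 2 := by
      field_simp; ring
    simp only [this]
    have h2 : (2 + x ^ 2) / (2 + 2 * x + x ^ 2) ^ 2 ≤ 1 := by
      rw [div_le_one (by positivity)]; nlinarith [sq_nonneg x, sq_nonneg (x ^ 2), pow_nonneg hx 3]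
    have h3 : 0 ≤ (2 + x ^ 2) / (2 + 2 * x + x ^ 2) ^ 2 := by positivity
    rw [abs_le]; constructor <;> linarith

/-- The tail integral of a nondecreasing function with Gaussian mean zero is nonnegative, and it
dominates the value at the left end point by the Mills ratio. This is the sign property behind the
bound for the second derivative of the Stein solution. -/
lemma mul_le_tail_of_monotone {g : ℝ → ℝ} (hg : Monotone g)
    (hi : Integrable (fun x => g x * gaussWeight x)) (h0 : ∫ x, g x * gaussWeight x = 0)
    {w : ℝ} (hw : 0 ≤ w) :
    w * g w ≤ (1 + w ^ 2) * (Real.exp (w ^ 2 / 2) * ∫ x in Set.Ioi w, g x * gaussWeight x) := by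
  have hE := Real.exp_pos (w ^ 2 / 2)
  rcases le_or_gt 0 (g w) with h | h
  -- for `g w ≥ 0` compare `g` with the constant `g w`; otherwise the left hand side is nonpositive
  · have h1 : g w * ∫ x in Set.Ioi w, gaussWeight x ≤ ∫ x in Set.Ioi w, g x * gaussWeight x := by
      rw [← integral_const_mul]
      refine setIntegral_mono_on (integrable_gaussWeight.const_mul _).integrableOn
        hi.integrableOn measurableSet_Ioi fun x hx => ?_
      exact mul_le_mul_of_nonneg_right (hg (le_of_lt hx)) (gaussWeight_pos x).le
    have h2 := mul_le_mul_of_nonneg_left (mills_lower hw) h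
    have h3 : g w * (w / (1 + w ^ 2) * gaussWeight w) ≤ ∫ x in Set.Ioi w, g x * gaussWeight x :=
      h2.trans h1
    calc w * g w = (1 + w ^ 2) * (Real.exp (w ^ 2 / 2) *
          (g w * (w / (1 + w ^ 2) * gaussWeight w))) := by
          have := exp_mul_gaussWeight w
          field_simp
          linear_combination (-w * g w) * this
      _ ≤ _ := by gcongr
  · have h1 : ∫ x in Set.Iic w, g x * gaussWeight x ≤ 0 := by
      refine setIntegral_nonpos measurableSet_Iic fun x hx => ?_
      exact mul_nonpos_of_nonpos_of_nonneg ((hg hx).trans h.le) (gaussWeight_pos x).le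
    have h2 := intervalIntegral.integral_Iic_add_Ioi (b := w) hi.integrableOn hi.integrableOn
    have h3 : 0 ≤ ∫ x in Set.Ioi w, g x * gaussWeight x := by linarith
    have : w * g w ≤ 0 := mul_nonpos_of_nonneg_of_nonpos hw h.le
    refine this.trans (by positivity)

/-- The hypotheses on the right hand side `g = h - E h(Z)` of the Stein equation with a
`1`-Lipschitz test function `h`. -/
structure IsSteinData (g : ℝ → ℝ) : Prop where
  lip : ∀ x y, |g x - g y| ≤ |x - y|
  mean_zero : ∫ x, g x * gaussWeight x = 0
  bound : ∀ x, |g x| ≤ 1 + x ^ 2 / 2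

namespace IsSteinData

variable {g : ℝ → ℝ}

lemma continuous (hg : IsSteinData g) : Continuous g := by
  refine (LipschitzWith.of_dist_le_mul (K := 1) fun x y => ?_).continuous
  simpa [Real.dist_eq] using hg.lip x y

lemma integrable (hg : IsSteinData g) : Integrable (fun x => g x * gaussWeight x) := by
  have h1 : Integrable (fun x => |g 0| * gaussWeight x + ‖x * gaussWeight x‖) :=
    (integrable_gaussWeight.const_mul _).add integrable_id_mul_gaussWeight.norm
  refine h1.mono' (hg.continuous.mul continuous_gaussWeight).aestronglyMeasurable
    (ae_of_all _ fun x => ?_)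
  have h2 := hg.lip x 0
  have h3 : |g x| ≤ |g 0| + |x| := by
    have := abs_add_le (g x - g 0) (g 0)
    rw [sub_add_cancel] at this
    rw [sub_zero] at h2
    linarith
  rw [norm_mul, norm_mul, Real.norm_of_nonneg (gaussWeight_pos x).le, Real.norm_eq_abs,
    Real.norm_eq_abs, ← add_mul]
  exact mul_le_mul_of_nonneg_right h3 (gaussWeight_pos x).le

lemma comp_neg (hg : IsSteinData g) : IsSteinData (fun x => g (-x)) where
  lip x y := by
    refine (hg.lip (-x) (-y)).trans_eq ?_
    rw [neg_sub_neg, abs_sub_comm]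
  mean_zero := by
    have := integral_neg_eq_self (fun x => g x * gaussWeight x) volume
    simp only [gaussWeight_neg] at this
    rw [this, hg.mean_zero]
  bound x := by simpa using hg.bound (-x)

lemma neg (hg : IsSteinData g) : IsSteinData (fun x => -g x) where
  lip x y := by
    refine (hg.lip y x).trans_eq' ?_ |>.trans_eq (abs_sub_comm _ _)
    congr 1; ring
  mean_zero := by simp [neg_mul, integral_neg, hg.mean_zero]
  bound x := by simpa using hg.bound x

/-- `mul_le_tail_of_monotone` for the nondecreasing function `x + g(x)`. -/
lemma tail_upper (hg : IsSteinData g) {w : ℝ} (hw : 0 ≤ w) :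
    w * g w - (1 + w ^ 2) * (Real.exp (w ^ 2 / 2) * ∫ x in Set.Ioi w, g x * gaussWeight x) ≤ 1 := by
  have hmono : Monotone (fun x => x + g x) := by
    intro x y hxy
    have := (abs_le.1 (hg.lip x y)).2
    rw [abs_sub_comm, abs_of_nonneg (sub_nonneg.2 hxy)] at this
    dsimp only; linarith
  have hsplit : (fun x => (x + g x) * gaussWeight x)
      = fun x => x * gaussWeight x + g x * gaussWeight x := by ext x; ring
  have hodd : ∫ x, x * gaussWeight x = 0 := by
    have := integral_neg_eq_self (fun x => x * gaussWeight x) volume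
    simp only [gaussWeight_neg, neg_mul, integral_neg] at this
    linarith
  have := mul_le_tail_of_monotone hmono
    (by rw [hsplit]; exact integrable_id_mul_gaussWeight.add hg.integrable)
    (by rw [hsplit, integral_add integrable_id_mul_gaussWeight hg.integrable, hodd, hg.mean_zero,
      add_zero]) hw
  rw [hsplit, integral_add integrable_id_mul_gaussWeight.integrableOn hg.integrable.integrableOn,
    integral_Ioi_id_mul_gaussWeight, mul_add (Real.exp _), exp_mul_gaussWeight] at this
  linarith

/-- The bound for the derivative of `w f(w)`, on the half line `w ≥ 0`. -/
lemma abs_tail_le (hg : IsSteinData g) {w : ℝ} (hw : 0 ≤ w) :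
    |w * g w - (1 + w ^ 2) * (Real.exp (w ^ 2 / 2) * ∫ x in Set.Ioi w, g x * gaussWeight x)|
      ≤ 1 := by
  have h1 := hg.tail_upper hw
  have h2 := hg.neg.tail_upper hw
  simp only [neg_mul, integral_neg] at h2
  rw [abs_le]; constructor <;> linarith

/-- The bound for the first derivative of the Stein solution, on the half line `w ≥ 0`.
With the Mills ratio `M` it is at most `(1 - w M) (1 + w + w² / 2)`. -/
lemma abs_sub_tail_le (hg : IsSteinData g) {w : ℝ} (hw : 0 ≤ w) :
    |g w - w * (Real.exp (w ^ 2 / 2) * ∫ x in Set.Ioi w, g x * gaussWeight x)| ≤ 1 := by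
  set T := ∫ x in Set.Ioi w, gaussWeight x with hT
  set e := Real.exp (w ^ 2 / 2) with he
  have hE : 0 < e := Real.exp_pos _
  have heg : e * gaussWeight w = 1 := exp_mul_gaussWeight w
  have hdiff : |∫ x in Set.Ioi w, g x * gaussWeight x - g w * gaussWeight x|
      ≤ gaussWeight w - w * T := by
    calc _ ≤ ∫ x in Set.Ioi w, |g x * gaussWeight x - g w * gaussWeight x| :=
          abs_integral_le_integral_abs
      _ ≤ ∫ x in Set.Ioi w, (x * gaussWeight x - w * gaussWeight x) := by
          refine setIntegral_mono_on ?_ ?_ measurableSet_Ioi fun x hx => ?_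
          · exact (hg.integrable.sub (integrable_gaussWeight.const_mul _)).abs.integrableOn
          · exact (integrable_id_mul_gaussWeight.sub
              (integrable_gaussWeight.const_mul _)).integrableOn
          · rw [← sub_mul, ← sub_mul, abs_mul, abs_of_pos (gaussWeight_pos x)]
            refine mul_le_mul_of_nonneg_right ?_ (gaussWeight_pos x).le
            exact (hg.lip x w).trans_eq (abs_of_pos (sub_pos.2 hx))
      _ = _ := by
          rw [integral_sub integrable_id_mul_gaussWeight.integrableOn
            (integrable_gaussWeight.const_mul _).integrableOn, integral_Ioi_id_mul_gaussWeight,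
            integral_const_mul]
  rw [integral_sub hg.integrable.integrableOn (integrable_gaussWeight.const_mul _).integrableOn,
    integral_const_mul, ← hT] at hdiff
  set G := ∫ x in Set.Ioi w, g x * gaussWeight x
  have hq : 0 < 2 + 2 * w + w ^ 2 := by positivity
  have hM : (2 + w) / (2 + 2 * w + w ^ 2) ≤ e * T := by
    have := mul_le_mul_of_nonneg_left (mills_lower' hw) hE.le
    calc _ = e * ((2 + w) / (2 + 2 * w + w ^ 2) * gaussWeight w) := by
          rw [mul_left_comm, heg, mul_one]
      _ ≤ _ := this
  have hnn : 0 ≤ 1 - w * (e * T) := by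
    have := mul_nonneg hE.le (hdiff.trans' (abs_nonneg _))
    nlinarith
  have h1 : |w * (e * (G - g w * T))| ≤ w * (1 - w * (e * T)) := by
    rw [abs_mul, abs_of_nonneg hw, abs_mul, abs_of_pos hE]
    refine mul_le_mul_of_nonneg_left ?_ hw
    calc _ ≤ e * (gaussWeight w - w * T) := mul_le_mul_of_nonneg_left hdiff hE.le
      _ = _ := by rw [mul_sub, heg]; ring
  have h2 : |g w * (1 - w * (e * T))| ≤ (1 + w ^ 2 / 2) * (1 - w * (e * T)) := by
    rw [abs_mul, abs_of_nonneg hnn]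
    exact mul_le_mul_of_nonneg_right (hg.bound w) hnn
  have h3 : 1 - w * (e * T) ≤ 2 / (2 + 2 * w + w ^ 2) := by
    have := mul_le_mul_of_nonneg_left hM hw
    have h4 : 1 - w * ((2 + w) / (2 + 2 * w + w ^ 2)) = 2 / (2 + 2 * w + w ^ 2) := by
      field_simp; ring
    linarith
  calc |g w - w * (e * G)| = |g w * (1 - w * (e * T)) - w * (e * (G - g w * T))| := by
        congr 1; ring
    _ ≤ (1 + w ^ 2 / 2) * (1 - w * (e * T)) + w * (1 - w * (e * T)) :=
        (abs_sub _ _).trans (add_le_add h2 h1)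
    _ = (1 + w + w ^ 2 / 2) * (1 - w * (e * T)) := by ring
    _ ≤ (1 + w + w ^ 2 / 2) * (2 / (2 + 2 * w + w ^ 2)) := by gcongr
    _ = 1 := by field_simp

end IsSteinData

/-- The bounded solution `f(w) = e^{w²/2} ∫_{-∞}^w g(x) e^{-x²/2} dx` of the Stein equation
`f'(w) - w f(w) = g(w)`. -/
noncomputable def steinSol (g : ℝ → ℝ) (w : ℝ) : ℝ :=
  Real.exp (w ^ 2 / 2) * ∫ x in Set.Iic w, g x * gaussWeight x

namespace IsSteinData

variable {g : ℝ → ℝ}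

lemma hasDerivAt_steinSol (hg : IsSteinData g) (w : ℝ) :
    HasDerivAt (steinSol g) (w * steinSol g w + g w) w := by
  have hc : Continuous (fun x => g x * gaussWeight x) := hg.continuous.mul continuous_gaussWeight
  have h1 : HasDerivAt (fun u => ∫ x in Set.Iic u, g x * gaussWeight x)
      (g w * gaussWeight w) w := by
    have h2 : (fun u => ∫ x in Set.Iic u, g x * gaussWeight x)
        = fun u => (∫ x in Set.Iic (0 : ℝ), g x * gaussWeight x)
          + ∫ x in (0 : ℝ)..u, g x * gaussWeight x := by
      ext u
      have := intervalIntegral.integral_Iic_sub_Iic (a := 0) (b := u)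
        hg.integrable.integrableOn hg.integrable.integrableOn
      linarith
    rw [h2]
    exact (intervalIntegral.integral_hasDerivAt_right (hc.intervalIntegrable _ _)
      (hc.stronglyMeasurableAtFilter _ _) hc.continuousAt).const_add _
  have h3 : HasDerivAt (fun u : ℝ => Real.exp (u ^ 2 / 2)) (Real.exp (w ^ 2 / 2) * w) w := by
    have : HasDerivAt (fun u : ℝ => u ^ 2 / 2) w w := by
      exact ((hasDerivAt_pow 2 w).div_const 2).congr_deriv (by push_cast; ring)
    exact this.exp
  refine (h3.mul h1).congr_deriv ?_
  have := exp_mul_gaussWeight w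
  rw [steinSol]
  linear_combination g w * this

lemma steinSol_eq_tail (hg : IsSteinData g) (w : ℝ) :
    steinSol g w = -(Real.exp (w ^ 2 / 2) * ∫ x in Set.Ioi w, g x * gaussWeight x) := by
  have := intervalIntegral.integral_Iic_add_Ioi (b := w) hg.integrable.integrableOn
    hg.integrable.integrableOn
  rw [hg.mean_zero] at this
  rw [steinSol, eq_neg_of_add_eq_zero_left this, mul_neg]

/-- Reflection expresses the solution at `w ≤ 0` by a tail integral at `-w ≥ 0`. -/
lemma steinSol_eq_tail_comp_neg (w : ℝ) :
    steinSol g w = Real.exp ((-w) ^ 2 / 2) * ∫ x in Set.Ioi (-w), g (-x) * gaussWeight x := by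
  have := integral_comp_neg_Ioi (-w) (fun x => g x * gaussWeight x)
  simp only [gaussWeight_neg, neg_neg] at this
  rw [this, steinSol, neg_sq]

lemma abs_deriv_le (hg : IsSteinData g) (w : ℝ) : |w * steinSol g w + g w| ≤ 1 := by
  rcases le_total 0 w with hw | hw
  · rw [hg.steinSol_eq_tail]
    convert hg.abs_sub_tail_le hw using 2; ring
  · rw [steinSol_eq_tail_comp_neg]
    convert hg.comp_neg.abs_sub_tail_le (neg_nonneg.2 hw) using 2; simp; ring

lemma abs_deriv_id_mul_le (hg : IsSteinData g) (w : ℝ) :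
    |steinSol g w + w * (w * steinSol g w + g w)| ≤ 1 := by
  rcases le_total 0 w with hw | hw
  · rw [hg.steinSol_eq_tail]
    convert hg.abs_tail_le hw using 2; ring
  · rw [steinSol_eq_tail_comp_neg, ← abs_neg]
    convert hg.comp_neg.abs_tail_le (neg_nonneg.2 hw) using 2; simp; ring

/-- The derivative of the Stein solution is `2`-Lipschitz: it is the sum of `w f(w)` and `g(w)`,
and both summands are `1`-Lipschitz. -/
lemma abs_deriv_sub_le (hg : IsSteinData g) (x y : ℝ) :
    |(x * steinSol g x + g x) - (y * steinSol g y + g y)| ≤ 2 * |x - y| := by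
  have h1 : |x * steinSol g x - y * steinSol g y| ≤ 1 * |x - y| := by
    have := Convex.norm_image_sub_le_of_norm_hasDerivWithin_le (s := Set.univ)
      (f := fun w => w * steinSol g w) (C := 1)
      (f' := fun w => steinSol g w + w * (w * steinSol g w + g w))
      (fun w _ => by
        have := (hasDerivAt_id w).mul (hg.hasDerivAt_steinSol w)
        simp only [id, one_mul] at this
        exact this.hasDerivWithinAt)
      (fun w _ => hg.abs_deriv_id_mul_le w) convex_univ (Set.mem_univ y) (Set.mem_univ x)
    exact this
  have h2 := hg.lip x y
  calc _ = |(x * steinSol g x - y * steinSol g y) + (g x - g y)| := by congr 1; ring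
    _ ≤ _ := abs_add_le _ _
    _ ≤ _ := by linarith

end IsSteinData

lemma integrable_gaussian_of_lipschitz {h : ℝ → ℝ} (hh : ∀ x y, |h x - h y| ≤ |x - y|) :
    Integrable h (gaussianReal 0 1) := by
  have hc : Continuous h := by
    refine (LipschitzWith.of_dist_le_mul (K := 1) fun x y => ?_).continuous
    simpa [Real.dist_eq] using hh x y
  have h1 : Integrable (fun x : ℝ => x) (gaussianReal 0 1) :=
    (memLp_id_gaussianReal (μ := 0) (v := 1) 1).integrable le_rfl
  refine ((integrable_const |h 0|).add h1.norm).mono' hc.aestronglyMeasurable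
    (ae_of_all _ fun x => ?_)
  have h2 := hh x 0
  have := abs_add_le (h x - h 0) (h 0)
  rw [sub_add_cancel] at this
  rw [sub_zero] at h2
  simp only [Pi.add_apply, Real.norm_eq_abs]
  linarith

lemma isSteinData_sub_gaussian_mean {h : ℝ → ℝ} (hh : ∀ x y, |h x - h y| ≤ |x - y|) :
    IsSteinData (fun x => h x - ∫ z, h z ∂(gaussianReal 0 1)) where
  lip x y := by simpa using hh x y
  mean_zero := by
    have hi := integrable_gaussian_of_lipschitz hh
    have h1 : ∫ x, (h x - ∫ z, h z ∂(gaussianReal 0 1)) ∂(gaussianReal 0 1) = 0 := by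
      rw [integral_sub hi (integrable_const _)]; simp
    rw [integral_gaussianReal_eq_integral_smul one_ne_zero] at h1
    have h2 : ∀ x, gaussianPDFReal 0 1 x • (h x - ∫ z, h z ∂(gaussianReal 0 1))
        = (√(2 * Real.pi))⁻¹ * ((h x - ∫ z, h z ∂(gaussianReal 0 1)) * gaussWeight x) := by
      intro x
      simp only [gaussianPDFReal, gaussWeight, smul_eq_mul, NNReal.coe_one, mul_one, sub_zero,
        neg_div]
      ring
    simp_rw [h2, integral_const_mul] at h1
    exact (mul_eq_zero.1 h1).resolve_left (by positivity)
  -- `|h w - E h(Z)| ≤ E |w - Z| ≤ E (1 + (w - Z)²) / 2`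
  bound w := by
    have hi := integrable_gaussian_of_lipschitz hh
    have h1 : Integrable (fun x : ℝ => x) (gaussianReal 0 1) :=
      (memLp_id_gaussianReal (μ := 0) (v := 1) 1).integrable le_rfl
    have h2 : Integrable (fun x : ℝ => x ^ 2) (gaussianReal 0 1) :=
      (memLp_id_gaussianReal (μ := 0) (v := 1) 2).integrable_sq
    have hvar : ∫ x : ℝ, x ^ 2 ∂(gaussianReal 0 1) = 1 := by
      have := variance_id_gaussianReal (μ := 0) (v := 1)
      rw [variance_of_integral_eq_zero aemeasurable_id (by simp [integral_id_gaussianReal])] at this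
      simpa using this
    have hm : ∫ x : ℝ, x ∂(gaussianReal 0 1) = 0 := integral_id_gaussianReal
    have h3 : Integrable (fun z => (1 + w ^ 2) / 2 - w * z) (gaussianReal 0 1) :=
      (integrable_const _).sub (h1.const_mul w)
    have hq : ∫ z, ((1 + w ^ 2) / 2 - w * z + z ^ 2 / 2) ∂(gaussianReal 0 1) = 1 + w ^ 2 / 2 := by
      rw [integral_add h3 (h2.div_const 2),
        integral_sub (integrable_const _) (h1.const_mul w), integral_const_mul,
        integral_div 2 (fun x : ℝ => x ^ 2), hvar, hm]
      simp; ring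
    calc |h w - ∫ z, h z ∂(gaussianReal 0 1)|
        = |∫ z, (h w - h z) ∂(gaussianReal 0 1)| := by
          rw [integral_sub (integrable_const _) hi]; simp
      _ ≤ ∫ z, |h w - h z| ∂(gaussianReal 0 1) := abs_integral_le_integral_abs
      _ ≤ ∫ z, ((1 + w ^ 2) / 2 - w * z + z ^ 2 / 2) ∂(gaussianReal 0 1) := by
          refine integral_mono ((integrable_const _).sub hi).abs
            (h3.add (h2.div_const 2)) fun z => ?_
          refine (hh w z).trans ?_
          -- `|t| ≤ (1 + t²) / 2` with `t = w - z`
          have := sq_nonneg (|w - z| - 1)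
          have h3 := sq_abs (w - z)
          nlinarith
      _ = _ := hq

/-- The solution of the Stein equation for a `1`-Lipschitz test function `h` has a derivative that
is bounded by `1` and `2`-Lipschitz. -/
theorem exists_stein_solution {h : ℝ → ℝ} (hh : ∀ x y, |h x - h y| ≤ |x - y|) :
    ∃ f f' : ℝ → ℝ, (∀ w, HasDerivAt f (f' w) w) ∧
      (∀ w, f' w - w * f w = h w - ∫ z, h z ∂(gaussianReal 0 1)) ∧
      (∀ w, |f' w| ≤ 1) ∧ ∀ x y, |f' x - f' y| ≤ 2 * |x - y| := by
  have hg := isSteinData_sub_gaussian_mean hh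
  exact ⟨_, _, hg.hasDerivAt_steinSol, fun w => by ring, hg.abs_deriv_le, hg.abs_deriv_sub_le⟩

/-! ### Stein's method for locally dependent variables -/

lemma sub_sub_mul_le_sq_of_le {f f' : ℝ → ℝ} (hf : ∀ w, HasDerivAt f (f' w) w)
    (hlip : ∀ x y, |f' x - f' y| ≤ 2 * |x - y|) {a t : ℝ} (hat : a ≤ t) :
    f t - f a - (t - a) * f' a ≤ (t - a) ^ 2 := by
  have hd : ∀ s, HasDerivAt (fun s => (s - a) ^ 2 - (f s - (s - a) * f' a))
      (2 * (s - a) - (f' s - f' a)) s := by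
    intro s
    have h1 : HasDerivAt (fun s : ℝ => s - a) 1 s := (hasDerivAt_id s).sub_const a
    exact ((h1.pow 2).sub ((hf s).sub (h1.mul_const (f' a)))).congr_deriv (by push_cast; ring)
  have hmono : MonotoneOn (fun s => (s - a) ^ 2 - (f s - (s - a) * f' a)) (Set.Ici a) := by
    refine monotoneOn_of_deriv_nonneg (convex_Ici a)
      (fun s _ => (hd s).continuousAt.continuousWithinAt)
      (fun s _ => (hd s).differentiableAt.differentiableWithinAt) fun s hs => ?_
    rw [interior_Ici] at hs
    rw [(hd s).deriv]
    have := (abs_le.1 (hlip s a)).2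
    rw [abs_of_pos (sub_pos.2 hs)] at this
    linarith
  have := hmono Set.self_mem_Ici hat hat
  simp only [sub_self] at this
  linarith

/-- First order Taylor expansion of a function whose derivative is `2`-Lipschitz. -/
lemma abs_sub_sub_mul_le_sq {f f' : ℝ → ℝ} (hf : ∀ w, HasDerivAt f (f' w) w)
    (hlip : ∀ x y, |f' x - f' y| ≤ 2 * |x - y|) (a t : ℝ) :
    |f t - f a - (t - a) * f' a| ≤ (t - a) ^ 2 := by
  have key : ∀ {g g' : ℝ → ℝ} {b s : ℝ}, (∀ w, HasDerivAt g (g' w) w) →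
      (∀ x y, |g' x - g' y| ≤ 2 * |x - y|) → b ≤ s →
      |g s - g b - (s - b) * g' b| ≤ (s - b) ^ 2 := by
    intro g g' b s hg hl hbs
    have h1 := sub_sub_mul_le_sq_of_le hg hl hbs
    have h2 := sub_sub_mul_le_sq_of_le (f := fun x => -g x) (f' := fun x => -g' x)
      (fun w => (hg w).neg)
      (fun x y => by rw [neg_sub_neg, abs_sub_comm]; exact hl x y) hbs
    rw [abs_le]; constructor <;> linarith
  rcases le_total a t with h | h
  · exact key hf hlip h
  · have := key (g := fun x => f (-x)) (g' := fun x => -f' (-x)) (b := -a) (s := -t)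
      (fun w => ((hf (-w)).comp w (hasDerivAt_neg w)).congr_deriv (by ring))
      (fun x y => by
        rw [neg_sub_neg, abs_sub_comm]
        refine (hlip _ _).trans_eq ?_
        rw [neg_sub_neg, abs_sub_comm]) (neg_le_neg h)
    simp only [neg_neg] at this
    convert this using 1
    · congr 1; ring
    · ring

/-- The indices `j < N` with `|i - j| ≤ r`. -/
def nbr (N r i : ℕ) : Finset ℕ := (Finset.range N).filter fun j => i ≤ j + r ∧ j ≤ i + r

lemma mem_nbr {N r i j : ℕ} : j ∈ nbr N r i ↔ j < N ∧ i ≤ j + r ∧ j ≤ i + r := by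
  simp [nbr]

lemma card_nbr_le (N r i : ℕ) : (nbr N r i).card ≤ 2 * r + 1 := by
  have : nbr N r i ⊆ Finset.Icc (i - r) (i + r) := by
    intro j hj
    rw [mem_nbr] at hj
    rw [Finset.mem_Icc]; omega
  refine (Finset.card_le_card this).trans ?_
  rw [Nat.card_Icc]; omega

/-- Averaging a nonnegative family over all pairs of neighbours. -/
lemma sum_sum_nbr_le {N : ℕ} (r : ℕ) {a : ℕ → ℝ} (ha : ∀ i, 0 ≤ a i) :
    ∑ i ∈ Finset.range N, ∑ j ∈ nbr N r i, (a i + a j) / 2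
      ≤ (2 * r + 1) * ∑ i ∈ Finset.range N, a i := by
  have hswap : ∑ i ∈ Finset.range N, ∑ j ∈ nbr N r i, a j
      = ∑ i ∈ Finset.range N, ∑ j ∈ nbr N r i, a i := by
    refine Finset.sum_comm' fun i j => ?_
    simp only [mem_nbr, Finset.mem_range]; omega
  have h1 : ∑ i ∈ Finset.range N, ∑ j ∈ nbr N r i, (a i + a j) / 2
      = ∑ i ∈ Finset.range N, ∑ j ∈ nbr N r i, a i := by
    simp_rw [add_div, Finset.sum_add_distrib, ← Finset.sum_div, hswap]
    ring
  rw [h1, Finset.mul_sum]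
  refine Finset.sum_le_sum fun i _ => ?_
  rw [Finset.sum_const, nsmul_eq_mul]
  refine mul_le_mul_of_nonneg_right ?_ (ha i)
  exact_mod_cast card_nbr_le N r i

section LocalDependence

variable {Ω : Type*} [Finite Ω] [MeasurableSpace Ω] [DiscreteMeasurableSpace Ω]
  {μ : Measure Ω} [IsProbabilityMeasure μ]

lemma sq_integral_le_integral_sq (u : Ω → ℝ) : (∫ ω, u ω ∂μ) ^ 2 ≤ ∫ ω, u ω ^ 2 ∂μ := by
  have h := variance_nonneg u μ
  have h2 : MemLp u 2 μ :=
    (memLp_two_iff_integrable_sq (Measurable.of_discrete).aestronglyMeasurable).2 .of_finite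
  rw [variance_eq_sub h2] at h
  simpa using h

/-- The sum of the variables whose index is at distance at most `k` from `i`. -/
def nbrSum (Y : ℕ → Ω → ℝ) (N k i : ℕ) (ω : Ω) : ℝ := ∑ j ∈ nbr N k i, Y j ω

/-- Variables `Z i` that are independent at index distance more than `r` satisfy
`Var (∑ Z i) ≤ (2 r + 1) ∑ E (Z i)²`. -/
lemma integral_sq_sum_sub_le {N r : ℕ} {Z : ℕ → Ω → ℝ}
    (hind : ∀ i j, i < N → j < N → i + r < j → IndepFun (Z i) (Z j) μ) :
    ∫ ω, (∑ i ∈ Finset.range N, (Z i ω - ∫ ρ, Z i ρ ∂μ)) ^ 2 ∂μ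
      ≤ (2 * r + 1) * ∑ i ∈ Finset.range N, ∫ ω, Z i ω ^ 2 ∂μ := by
  set U : ℕ → Ω → ℝ := fun i ω => Z i ω - ∫ ρ, Z i ρ ∂μ with hU
  have hU0 : ∀ i, ∫ ω, U i ω ∂μ = 0 := fun i => by
    simp only [hU]; rw [integral_sub .of_finite .of_finite]; simp
  have hfar' : ∀ i j, i < N → j < N → i + r < j → ∫ ω, U i ω * U j ω ∂μ = 0 := by
    intro i j hi hj hij
    have h1 : IndepFun (U i) (U j) μ :=
      (hind i j hi hj hij).comp (φ := fun x => x - ∫ ρ, Z i ρ ∂μ) (ψ := fun x => x - ∫ ρ, Z j ρ ∂μ)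
        (by fun_prop) (by fun_prop)
    rw [h1.integral_fun_mul_eq_mul_integral (Measurable.of_discrete).aestronglyMeasurable
      (Measurable.of_discrete).aestronglyMeasurable, hU0, zero_mul]
  have hfar : ∀ i ∈ Finset.range N, ∀ j ∈ Finset.range N, j ∉ nbr N r i →
      ∫ ω, U i ω * U j ω ∂μ = 0 := by
    intro i hi j hj hij
    rw [Finset.mem_range] at hi hj
    rw [mem_nbr] at hij
    rcases lt_or_ge (i + r) j with h | h
    · exact hfar' i j hi hj h
    · rw [← hfar' j i hj hi (by omega)]
      simp_rw [mul_comm]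
  have hvar : ∀ i, ∫ ω, U i ω ^ 2 ∂μ ≤ ∫ ω, Z i ω ^ 2 ∂μ := by
    intro i
    have h1 : ∀ ω, U i ω ^ 2 = Z i ω ^ 2 - 2 * (∫ ρ, Z i ρ ∂μ) * Z i ω + (∫ ρ, Z i ρ ∂μ) ^ 2 :=
      fun ω => by simp only [hU]; ring
    simp_rw [h1]
    rw [integral_add .of_finite .of_finite, integral_sub .of_finite .of_finite, integral_const_mul]
    simp
    nlinarith [sq_nonneg (∫ ρ, Z i ρ ∂μ)]
  calc ∫ ω, (∑ i ∈ Finset.range N, U i ω) ^ 2 ∂μ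
      = ∑ i ∈ Finset.range N, ∑ j ∈ Finset.range N, ∫ ω, U i ω * U j ω ∂μ := by
        simp_rw [sq, Finset.sum_mul_sum]
        rw [integral_finsetSum _ fun _ _ => .of_finite]
        refine Finset.sum_congr rfl fun i _ => integral_finsetSum _ fun _ _ => .of_finite
    _ = ∑ i ∈ Finset.range N, ∑ j ∈ nbr N r i, ∫ ω, U i ω * U j ω ∂μ := by
        refine Finset.sum_congr rfl fun i hi => ?_
        exact (Finset.sum_subset (Finset.filter_subset _ _) fun j hj hij => hfar i hi j hj hij).symm
    _ ≤ ∑ i ∈ Finset.range N, ∑ j ∈ nbr N r i,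
          (∫ ω, U i ω ^ 2 ∂μ + ∫ ω, U j ω ^ 2 ∂μ) / 2 := by
        refine Finset.sum_le_sum fun i _ => Finset.sum_le_sum fun j _ => ?_
        rw [← integral_add .of_finite .of_finite, ← integral_div]
        refine integral_mono .of_finite .of_finite fun ω => ?_
        nlinarith [sq_nonneg (U i ω - U j ω)]
    _ ≤ (2 * r + 1) * ∑ i ∈ Finset.range N, ∫ ω, U i ω ^ 2 ∂μ :=
        sum_sum_nbr_le r fun i => integral_nonneg fun ω => sq_nonneg _
    _ ≤ _ := by
        refine mul_le_mul_of_nonneg_left (Finset.sum_le_sum fun i _ => hvar i) (by positivity)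

/-- Stein's method for locally dependent summands: `Y i` is independent of the sum of the `Y j`
with `|i - j| > k`, and the products `Y i * S i` with the neighbourhood sums `S i` are independent
at index distance more than `3 k`. -/
theorem stein_local_dependence {N k : ℕ} {Y : ℕ → Ω → ℝ} {σ : ℝ} (hσ : 0 < σ)
    (hmean : ∀ i < N, ∫ ω, Y i ω ∂μ = 0)
    (hvar : ∫ ω, (∑ i ∈ Finset.range N, Y i ω) ^ 2 ∂μ = σ ^ 2)
    (hind : ∀ i < N, IndepFun (Y i)
      (fun ω => ∑ j ∈ (Finset.range N).filter (fun j => j ∉ nbr N k i), Y j ω) μ)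
    (hind' : ∀ i j, i < N → j < N → i + 3 * k < j →
      IndepFun (fun ω => Y i ω * nbrSum Y N k i ω) (fun ω => Y j ω * nbrSum Y N k j ω) μ)
    {h : ℝ → ℝ} (hh : ∀ x y, |h x - h y| ≤ |x - y|) :
    |∫ ω, h (1 / σ * ∑ i ∈ Finset.range N, Y i ω) ∂μ - ∫ z, h z ∂(gaussianReal 0 1)|
      ≤ 1 / σ ^ 3 * ∑ i ∈ Finset.range N, ∫ ω, |Y i ω| * nbrSum Y N k i ω ^ 2 ∂μ
        + 1 / σ ^ 2 * √((6 * k + 1) *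
          ∑ i ∈ Finset.range N, ∫ ω, (Y i ω * nbrSum Y N k i ω) ^ 2 ∂μ) := by
  obtain ⟨f, f', hd, hstein, hb, hlip⟩ := exists_stein_solution hh
  set S := nbrSum Y N k with hS
  set V : Ω → ℝ := fun ω => 1 / σ * ∑ i ∈ Finset.range N, Y i ω with hV
  set R : ℕ → Ω → ℝ := fun i ω =>
    ∑ j ∈ (Finset.range N).filter (fun j => j ∉ nbr N k i), Y j ω with hR
  set T : Ω → ℝ := fun ω => ∑ i ∈ Finset.range N, Y i ω * S i ω with hT
  have hsplit : ∀ i ω, ∑ j ∈ Finset.range N, Y j ω = S i ω + R i ω := by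
    intro i ω
    have h1 : nbr N k i = (Finset.range N).filter (fun j => j ∈ nbr N k i) := by
      ext j; simp only [Finset.mem_filter, Finset.mem_range, mem_nbr]; tauto
    have h2 : S i ω = ∑ j ∈ (Finset.range N).filter (fun j => j ∈ nbr N k i), Y j ω := by
      rw [← h1, hS, nbrSum]
    rw [h2, Finset.sum_filter_add_sum_filter_not]
  have hmul0 : ∀ i < N, ∀ φ : ℝ → ℝ, Measurable φ → ∫ ω, Y i ω * φ (R i ω) ∂μ = 0 := by
    intro i hi φ hφ
    have h1 := (hind i hi).comp measurable_id hφ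
    have h2 := h1.integral_fun_mul_eq_mul_integral (Measurable.of_discrete).aestronglyMeasurable
      (Measurable.of_discrete).aestronglyMeasurable
    simp only [Function.comp_def, id] at h2
    rw [h2, hmean i hi, zero_mul]
  -- the neighbourhood products carry the whole variance
  have hET : ∫ ω, T ω ∂μ = σ ^ 2 := by
    rw [← hvar, hT, integral_finsetSum _ fun _ _ => .of_finite]
    have h1 : ∀ ω, (∑ i ∈ Finset.range N, Y i ω) ^ 2
        = ∑ i ∈ Finset.range N, (Y i ω * S i ω + Y i ω * R i ω) := by
      intro ω
      rw [sq, Finset.sum_mul]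
      refine Finset.sum_congr rfl fun i _ => ?_
      rw [hsplit i ω]; ring
    simp_rw [h1]
    rw [integral_finsetSum _ fun _ _ => .of_finite]
    refine Finset.sum_congr rfl fun i hi => ?_
    rw [integral_add .of_finite .of_finite,
      hmul0 i (Finset.mem_range.1 hi) (fun x => x) measurable_id, add_zero]
  have hfm : Measurable f :=
    (continuous_iff_continuousAt.2 fun w => (hd w).continuousAt).measurable
  -- replace `f (V)` by its increment over the neighbourhood of `i`
  have hVf : ∫ ω, V ω * f (V ω) ∂μ
      = 1 / σ * ∑ i ∈ Finset.range N, ∫ ω, Y i ω * (f (V ω) - f (1 / σ * R i ω)) ∂μ := by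
    have h1 : ∀ ω, V ω * f (V ω) = 1 / σ * ∑ i ∈ Finset.range N, Y i ω * f (V ω) := by
      intro ω; rw [← Finset.sum_mul, ← mul_assoc]
    simp_rw [h1]
    rw [integral_const_mul, integral_finsetSum _ fun _ _ => .of_finite]
    congr 1
    refine Finset.sum_congr rfl fun i hi => ?_
    simp_rw [mul_sub]
    rw [integral_sub .of_finite .of_finite, hmul0 i (Finset.mem_range.1 hi)
      (fun x => f (1 / σ * x)) (hfm.comp (measurable_const_mul _)), sub_zero]
  set E : ℕ → Ω → ℝ := fun i ω =>
    Y i ω * (f (1 / σ * R i ω) - f (V ω) - (1 / σ * R i ω - V ω) * f' (V ω)) with hEdef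
  have hident : ∫ ω, h (V ω) ∂μ - ∫ z, h z ∂(gaussianReal 0 1)
      = 1 / σ ^ 2 * ∫ ω, f' (V ω) * (σ ^ 2 - T ω) ∂μ
        + 1 / σ * ∑ i ∈ Finset.range N, ∫ ω, E i ω ∂μ := by
    have h1 : ∫ ω, h (V ω) ∂μ - ∫ z, h z ∂(gaussianReal 0 1)
        = ∫ ω, f' (V ω) ∂μ - ∫ ω, V ω * f (V ω) ∂μ := by
      rw [← integral_sub .of_finite .of_finite]
      simp_rw [hstein]
      rw [integral_sub .of_finite .of_finite]
      simp
    rw [h1, hVf, ← integral_finsetSum _ fun _ _ => .of_finite, ← integral_const_mul,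
      ← integral_finsetSum _ fun _ _ => .of_finite, ← integral_const_mul, ← integral_const_mul,
      ← integral_sub .of_finite .of_finite, ← integral_add .of_finite .of_finite]
    congr 1
    ext ω
    have h2 : ∑ i ∈ Finset.range N, E i ω
        = 1 / σ * f' (V ω) * T ω
          - ∑ i ∈ Finset.range N, Y i ω * (f (V ω) - f (1 / σ * R i ω)) := by
      rw [hT, Finset.mul_sum, ← Finset.sum_sub_distrib]
      refine Finset.sum_congr rfl fun i _ => ?_
      have : 1 / σ * R i ω - V ω = -(1 / σ * S i ω) := by
        rw [hV]; simp only; rw [hsplit i ω]; ring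
      simp only [hEdef, this]; ring
    rw [h2]
    field_simp
    ring
  have hE : ∀ i, |∫ ω, E i ω ∂μ| ≤ 1 / σ ^ 2 * ∫ ω, |Y i ω| * S i ω ^ 2 ∂μ := by
    intro i
    refine abs_integral_le_integral_abs.trans ?_
    rw [← integral_const_mul]
    refine integral_mono .of_finite .of_finite fun ω => ?_
    have h1 := abs_sub_sub_mul_le_sq hd hlip (V ω) (1 / σ * R i ω)
    have h2 : (1 / σ * R i ω - V ω) ^ 2 = 1 / σ ^ 2 * S i ω ^ 2 := by
      rw [hV]; simp only; rw [hsplit i ω]; field_simp; ring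
    rw [h2] at h1
    simp only [hEdef, abs_mul (Y i ω)]
    calc _ ≤ |Y i ω| * (1 / σ ^ 2 * S i ω ^ 2) := mul_le_mul_of_nonneg_left h1 (abs_nonneg _)
      _ = _ := by ring
  have hTvar : |∫ ω, f' (V ω) * (σ ^ 2 - T ω) ∂μ|
      ≤ √((6 * k + 1) * ∑ i ∈ Finset.range N, ∫ ω, (Y i ω * S i ω) ^ 2 ∂μ) := by
    calc _ ≤ ∫ ω, |f' (V ω) * (σ ^ 2 - T ω)| ∂μ := abs_integral_le_integral_abs
      _ ≤ ∫ ω, |T ω - σ ^ 2| ∂μ := by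
          refine integral_mono .of_finite .of_finite fun ω => ?_
          simp only [abs_mul, abs_sub_comm (σ ^ 2)]
          exact mul_le_of_le_one_left (abs_nonneg _) (hb _)
      _ ≤ √(∫ ω, |T ω - σ ^ 2| ^ 2 ∂μ) := Real.le_sqrt_of_sq_le (sq_integral_le_integral_sq _)
      _ ≤ _ := by
          refine Real.sqrt_le_sqrt ?_
          have h1 := integral_sq_sum_sub_le (μ := μ) (r := 3 * k)
            (Z := fun i ω => Y i ω * S i ω) hind'
          have h2 : ∀ ω, |T ω - σ ^ 2| ^ 2 = (∑ i ∈ Finset.range N,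
              (Y i ω * S i ω - ∫ ρ, Y i ρ * S i ρ ∂μ)) ^ 2 := by
            intro ω
            rw [sq_abs, Finset.sum_sub_distrib, ← hET, hT,
              integral_finsetSum _ fun _ _ => .of_finite]
          simp_rw [h2]
          refine h1.trans_eq ?_
          push_cast; ring
  rw [hident]
  refine (abs_add_le _ _).trans ?_
  rw [add_comm]
  refine add_le_add ?_ ?_
  · rw [abs_mul, abs_of_pos (by positivity)]
    calc _ ≤ 1 / σ * ∑ i ∈ Finset.range N, 1 / σ ^ 2 * ∫ ω, |Y i ω| * S i ω ^ 2 ∂μ := by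
          refine mul_le_mul_of_nonneg_left ?_ (by positivity)
          exact (Finset.abs_sum_le_sum_abs _ _).trans (Finset.sum_le_sum fun i _ => hE i)
      _ = _ := by rw [← Finset.mul_sum]; field_simp
  · rw [abs_mul, abs_of_pos (by positivity)]
    exact mul_le_mul_of_nonneg_left hTvar (by positivity)

/-- Fourth moments control the second moments of the products with the neighbourhood sums. -/
lemma sum_integral_sq_mul_nbrSum_le (N k : ℕ) (Y : ℕ → Ω → ℝ) :
    ∑ i ∈ Finset.range N, ∫ ω, (Y i ω * nbrSum Y N k i ω) ^ 2 ∂μ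
      ≤ (2 * k + 1) ^ 2 * ∑ i ∈ Finset.range N, ∫ ω, Y i ω ^ 4 ∂μ := by
  have h1 : ∀ i, ∫ ω, (Y i ω * nbrSum Y N k i ω) ^ 2 ∂μ
      ≤ (2 * k + 1) * ∑ j ∈ nbr N k i, (∫ ω, Y i ω ^ 4 ∂μ + ∫ ω, Y j ω ^ 4 ∂μ) / 2 := by
    intro i
    simp_rw [← integral_add (μ := μ) (f := fun ω => Y i ω ^ 4) .of_finite .of_finite,
      ← integral_div]
    rw [← integral_finsetSum _ fun _ _ => .of_finite, ← integral_const_mul]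
    refine integral_mono .of_finite .of_finite fun ω => ?_
    simp only [nbrSum]
    have h2 : (∑ j ∈ nbr N k i, Y j ω) ^ 2 ≤ (2 * k + 1) * ∑ j ∈ nbr N k i, Y j ω ^ 2 := by
      refine sq_sum_le_card_mul_sum_sq.trans ?_
      refine mul_le_mul_of_nonneg_right ?_ (Finset.sum_nonneg fun _ _ => sq_nonneg _)
      exact_mod_cast card_nbr_le N k i
    calc _ = Y i ω ^ 2 * (∑ j ∈ nbr N k i, Y j ω) ^ 2 := by ring
      _ ≤ Y i ω ^ 2 * ((2 * k + 1) * ∑ j ∈ nbr N k i, Y j ω ^ 2) := by gcongr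
      _ = (2 * k + 1) * ∑ j ∈ nbr N k i, Y i ω ^ 2 * Y j ω ^ 2 := by
          rw [mul_left_comm, Finset.mul_sum]
      _ ≤ _ := by
          refine mul_le_mul_of_nonneg_left (Finset.sum_le_sum fun j _ => ?_) (by positivity)
          nlinarith [sq_nonneg (Y i ω ^ 2 - Y j ω ^ 2)]
  refine (Finset.sum_le_sum fun i _ => h1 i).trans ?_
  rw [← Finset.mul_sum, sq, mul_assoc]
  refine mul_le_mul_of_nonneg_left ?_ (by positivity)
  exact sum_sum_nbr_le k fun i => integral_nonneg fun ω => by positivity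

end LocalDependence

/-! ### Cuts of regular permutations and their law -/

section Cuts

variable {n : ℕ}

/-- `π` has a cut at `j` if `π(j) ≥ j`. For a `b₂`-regular permutation the only other possibility
is `π(j) = j - 1`, and the cuts are the left end points of the cycles. By convention `0` and all
`j ≥ n` are cuts, for every `π`. -/
def IsCut (π : Equiv.Perm (Fin n)) (j : ℕ) : Prop := ∀ x : Fin n, (x : ℕ) = j → j ≤ π x

lemma isCut_zero (π : Equiv.Perm (Fin n)) : IsCut π 0 := fun _ _ => Nat.zero_le _

lemma isCut_of_le (π : Equiv.Perm (Fin n)) {j : ℕ} (h : n ≤ j) : IsCut π j :=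
  fun x hx => absurd x.2 (by omega)

variable {π : Equiv.Perm (Fin n)}

lemma isBRegular_b2_iff : IsBRegular (b2 n) π ↔ ∀ x : Fin n, (x : ℕ) ≤ π x + 1 := by
  simp [IsBRegular, b2]

lemma exists_of_not_isCut (hπ : IsBRegular (b2 n) π) {j : ℕ} (h : ¬ IsCut π j) :
    ∃ x : Fin n, (x : ℕ) = j ∧ (π x : ℕ) + 1 = j := by
  rw [isBRegular_b2_iff] at hπ
  simp only [IsCut, not_forall, not_le] at h
  obtain ⟨x, hx, hlt⟩ := h
  exact ⟨x, hx, by have := hπ x; omega⟩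

lemma IsCut.le_apply (hπ : IsBRegular (b2 n) π) {j : ℕ} (h : IsCut π j) {x : Fin n}
    (hx : j ≤ (x : ℕ)) : j ≤ (π x : ℕ) := by
  rw [isBRegular_b2_iff] at hπ
  rcases hx.eq_or_lt with h' | h'
  · exact h x h'.symm
  · have := hπ x; omega

/-- The points below a cut are permuted among themselves. -/
lemma IsCut.apply_lt (hπ : IsBRegular (b2 n) π) {j : ℕ} (h : IsCut π j) {x : Fin n}
    (hx : (x : ℕ) < j) : (π x : ℕ) < j := by
  by_contra! hle
  have hmaps : Set.MapsTo π {y : Fin n | j ≤ (y : ℕ)} {y : Fin n | j ≤ (y : ℕ)} :=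
    fun y hy => h.le_apply hπ hy
  have h1 := Equiv.Perm.perm_symm_mapsTo_of_mapsTo π hmaps (x := π x) hle
  simp at h1
  omega

/-- Every point is followed by a first cut. -/
lemma exists_next_cut (π : Equiv.Perm (Fin n)) {i : ℕ} (hi : i < n) :
    ∃ m, i < m ∧ m ≤ n ∧ IsCut π m ∧ ∀ j, i < j → j < m → ¬ IsCut π j := by
  classical
  have hex : ∃ m, i < m ∧ IsCut π m := ⟨n, hi, isCut_of_le π le_rfl⟩
  refine ⟨Nat.find hex, (Nat.find_spec hex).1, Nat.find_le ⟨hi, isCut_of_le π le_rfl⟩,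
    (Nat.find_spec hex).2, fun j hij hj hc => Nat.find_min hex hj ⟨hij, hc⟩⟩

/-- The interval `[i, i + k)` is a cycle of a `b₂`-regular permutation if and only if `i` and
`i + k` are consecutive cuts. -/
lemma hasCycleAt_iff (hπ : IsBRegular (b2 n) π) {k i : ℕ} (hk : 1 ≤ k) (hi : i + k ≤ n) :
    HasCycleAt k i π ↔ IsCut π i ∧ IsCut π (i + k) ∧ ∀ j, i < j → j < i + k → ¬ IsCut π j := by
  constructor
  · rintro ⟨h1, h2⟩
    refine ⟨fun x hx => ?_, fun x hx => ?_, fun j hij hj hc => ?_⟩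
    · have := h1 x hx; omega
    · by_contra! hlt
      have h3 := isBRegular_b2_iff.1 hπ x
      have h4 := h1 ⟨i, by omega⟩ rfl
      have h5 : π x = π ⟨i, by omega⟩ := Fin.ext (by omega)
      have h6 := congrArg Fin.val (π.injective h5)
      simp only at h6
      omega
    · have h3 := h2 ⟨j, by omega⟩ hij hj
      have h4 := hc ⟨j, by omega⟩ rfl
      simp only at h3
      omega
  · rintro ⟨h1, h2, h3⟩
    have hin : ∀ x : Fin n, i < (x : ℕ) → (x : ℕ) < i + k → (π x : ℕ) + 1 = (x : ℕ) := by
      intro x hix hxk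
      obtain ⟨y, hy, hy'⟩ := exists_of_not_isCut hπ (h3 x hix hxk)
      obtain rfl : y = x := Fin.ext hy
      exact hy'
    refine ⟨fun x hx => ?_, hin⟩
    -- the preimage of the last point of the block can only be its first point
    obtain ⟨y, hy⟩ := π.surjective ⟨i + k - 1, by omega⟩
    have hy' : (π y : ℕ) = i + k - 1 := by rw [hy]
    have hiy : i ≤ (y : ℕ) := by
      by_contra! h
      have := h1.apply_lt hπ h
      omega
    have hyk : (y : ℕ) < i + k := by
      by_contra! h
      have := h2.le_apply hπ h
      omega
    rcases hiy.eq_or_lt with h | h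
    · obtain rfl : y = x := Fin.ext (by omega)
      omega
    · have := hin y h hyk; omega

/-- Every cut is the left end point of a cycle. -/
lemma exists_hasCycleAt (hπ : IsBRegular (b2 n) π) {i : ℕ} (hi : i < n) (hc : IsCut π i) :
    ∃ k, 1 ≤ k ∧ i + k ≤ n ∧ IsCut π (i + k) ∧ (∀ j, i < j → j < i + k → ¬ IsCut π j) ∧
      HasCycleAt k i π := by
  obtain ⟨m, him, hmn, hm, hmin⟩ := exists_next_cut π hi
  obtain ⟨k, rfl⟩ := Nat.exists_eq_add_of_lt him
  rw [add_assoc] at *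
  exact ⟨k + 1, by omega, hmn, hm, hmin, (hasCycleAt_iff hπ (by omega) hmn).2 ⟨hc, hm, hmin⟩⟩

/-- A `b₂`-regular permutation is determined by its cuts. -/
lemma eq_of_isCut_iff {ρ : Equiv.Perm (Fin n)} (hπ : IsBRegular (b2 n) π)
    (hρ : IsBRegular (b2 n) ρ) (h : ∀ j, IsCut π j ↔ IsCut ρ j) : π = ρ := by
  ext x
  by_cases hc : IsCut π x
  · obtain ⟨k, hk, hkn, hm, hmin, hcyc⟩ := exists_hasCycleAt hπ x.2 hc
    have hcyc' : HasCycleAt k x ρ := by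
      rw [hasCycleAt_iff hρ hk hkn, ← h, ← h]
      exact ⟨hc, hm, fun j h1 h2 h3 => hmin j h1 h2 ((h j).2 h3)⟩
    have h1 := hcyc.1 x rfl
    have h2 := hcyc'.1 x rfl
    omega
  · obtain ⟨y, hy, hy'⟩ := exists_of_not_isCut hπ hc
    obtain ⟨z, hz, hz'⟩ := exists_of_not_isCut hρ (fun h' => hc ((h x).2 h'))
    obtain rfl : y = x := Fin.ext hy
    obtain rfl : z = y := Fin.ext hz
    omega

/-- Every set of cuts occurs. -/
lemma exists_isBRegular_isCut_iff (n : ℕ) (A : Set ℕ) :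
    ∃ π : Equiv.Perm (Fin n), IsBRegular (b2 n) π ∧ ∀ j, 1 ≤ j → j < n → (IsCut π j ↔ j ∈ A) := by
  classical
  have hex : ∀ x : ℕ, ∃ m, x < m ∧ (m ∈ A ∨ n ≤ m) :=
    fun x => ⟨x + n + 1, by omega, Or.inr (by omega)⟩
  -- `π` maps a cut to the point before the next cut, and any other point to its predecessor
  set next : ℕ → ℕ := fun x => Nat.find (hex x) with hnext
  have hlt : ∀ x, x < next x := fun x => (Nat.find_spec (hex x)).1
  have hspec : ∀ x, next x ∈ A ∨ n ≤ next x := fun x => (Nat.find_spec (hex x)).2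
  have hle : ∀ x m, x < m → (m ∈ A ∨ n ≤ m) → next x ≤ m :=
    fun x m h1 h2 => Nat.find_le ⟨h1, h2⟩
  have hlen : ∀ x, x < n → next x ≤ n := fun x hx => hle x n hx (Or.inr le_rfl)
  set f : Fin n → Fin n := fun x =>
    if (x : ℕ) = 0 ∨ (x : ℕ) ∈ A then ⟨next x - 1, by have := hlen x x.2; have := x.2; omega⟩
    else ⟨x - 1, by have := x.2; omega⟩ with hf
  have hf1 : ∀ x : Fin n, ((x : ℕ) = 0 ∨ (x : ℕ) ∈ A) → (f x : ℕ) + 1 = next x := by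
    intro x hx
    have := hlt x
    simp only [hf, if_pos hx]; omega
  have hf2 : ∀ x : Fin n, ¬ ((x : ℕ) = 0 ∨ (x : ℕ) ∈ A) → (f x : ℕ) + 1 = x := by
    intro x hx
    simp only [hf, if_neg hx]; omega
  have hmix : ∀ x y : Fin n, ((x : ℕ) = 0 ∨ (x : ℕ) ∈ A) → ¬ ((y : ℕ) = 0 ∨ (y : ℕ) ∈ A) →
      f x ≠ f y := by
    intro x y hx hy hxy
    have h1 := hf1 x hx
    have h2 := hf2 y hy
    rw [hxy, h2] at h1
    have := hspec x
    rw [← h1] at this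
    exact hy (Or.inr (this.resolve_right y.2.not_ge))
  have hmono : ∀ x y : Fin n, ((y : ℕ) = 0 ∨ (y : ℕ) ∈ A) → (x : ℕ) < y → next x < next y := by
    intro x y hy hxy
    have h1 := hle x y hxy (by rcases hy with h | h; · omega
                               · exact Or.inl h)
    exact h1.trans_lt (hlt y)
  have hinj : Function.Injective f := by
    intro x y hxy
    by_cases hx : (x : ℕ) = 0 ∨ (x : ℕ) ∈ A <;> by_cases hy : (y : ℕ) = 0 ∨ (y : ℕ) ∈ A
    · have h1 := hf1 x hx
      have h2 := hf1 y hy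
      rw [hxy, h2] at h1
      rcases lt_trichotomy (x : ℕ) y with h | h | h
      · have := hmono x y hy h; omega
      · exact Fin.ext h
      · have := hmono y x hx h; omega
    · exact absurd hxy (hmix x y hx hy)
    · exact absurd hxy.symm (hmix y x hy hx)
    · have h1 := hf2 x hx
      have h2 := hf2 y hy
      rw [hxy, h2] at h1
      exact Fin.ext h1.symm
  refine ⟨Equiv.ofBijective f (Finite.injective_iff_bijective.1 hinj), ?_, fun j hj hjn => ?_⟩
  · rw [isBRegular_b2_iff]
    intro x
    rw [Equiv.ofBijective_apply]
    by_cases hx : (x : ℕ) = 0 ∨ (x : ℕ) ∈ A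
    · have := hf1 x hx; have := hlt x; omega
    · have := hf2 x hx; omega
  · constructor
    · intro h
      have h1 := h ⟨j, hjn⟩ rfl
      rw [Equiv.ofBijective_apply] at h1
      by_contra hA
      have := hf2 ⟨j, hjn⟩ (by simp only; rintro (h | h); · omega
                               · exact hA h)
      simp only at this
      omega
    · rintro hA x rfl
      rw [Equiv.ofBijective_apply]
      have := hf1 x (Or.inr hA)
      have := hlt x
      omega

noncomputable instance (π : Equiv.Perm (Fin n)) : DecidablePred (IsCut π) := Classical.decPred _

/-- The cuts of `π` strictly between `0` and `n`. -/
noncomputable def cutSet (π : Equiv.Perm (Fin n)) : Finset ℕ := (Finset.Ico 1 n).filter (IsCut π)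

lemma mem_cutSet {j : ℕ} : j ∈ cutSet π ↔ (1 ≤ j ∧ j < n) ∧ IsCut π j := by
  simp [cutSet]

/-- The regular permutations with cuts on `A` and no cuts on `B` correspond to the sets between `A`
and the complement of `B`. -/
lemma bijOn_cutSet (A B : Finset ℕ) :
    Set.BijOn cutSet {π : Equiv.Perm (Fin n) | IsBRegular (b2 n) π ∧ A ⊆ cutSet π ∧
      Disjoint B (cutSet π)} (Finset.Icc A (Finset.Ico 1 n \ B)) := by
  refine ⟨fun π hπ => ?_, fun π hπ ρ hρ h => ?_, fun C hC => ?_⟩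
  · rw [Finset.mem_coe, Finset.mem_Icc]
    exact ⟨hπ.2.1, Finset.subset_sdiff.2 ⟨Finset.filter_subset _ _, hπ.2.2.symm⟩⟩
  · refine eq_of_isCut_iff hπ.1 hρ.1 fun j => ?_
    have := Finset.ext_iff.1 h j
    simp only [mem_cutSet] at this
    rcases Nat.eq_zero_or_pos j with rfl | hj
    · simp [isCut_zero]
    · rcases lt_or_ge j n with hjn | hjn
      · tauto
      · simp [isCut_of_le _ hjn]
  · rw [Finset.mem_coe, Finset.mem_Icc] at hC
    obtain ⟨π, hπ, hcut⟩ := exists_isBRegular_isCut_iff n (C : Set ℕ)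
    have hsub : C ⊆ Finset.Ico 1 n := hC.2.trans Finset.sdiff_subset
    have heq : cutSet π = C := by
      ext j
      rw [mem_cutSet]
      constructor
      · rintro ⟨⟨h1, h2⟩, h3⟩
        exact (hcut j h1 h2).1 h3
      · intro hj
        have h1 := Finset.mem_Ico.1 (hsub hj)
        exact ⟨h1, (hcut j h1.1 h1.2).2 hj⟩
    exact ⟨π, ⟨hπ, by rw [heq]; exact hC.1, by
      rw [heq]; exact (Finset.subset_sdiff.1 hC.2).2.symm⟩, heq⟩

end Cuts

section Law

instance (n : ℕ) : DiscreteMeasurableSpace (Equiv.Perm (Fin n)) := ⟨fun _ => trivial⟩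

variable (n : ℕ)

instance : IsProbabilityMeasure (unifB2 n) := by
  obtain ⟨π, hπ, -⟩ := exists_isBRegular_isCut_iff n ∅
  exact isProbabilityMeasure_uniformOn (Set.toFinite _) ⟨π, hπ⟩

lemma ae_isBRegular : ∀ᵐ π ∂(unifB2 n), IsBRegular (b2 n) π := by
  rw [ae_iff, unifB2, uniformOn_eq_zero_iff (Set.toFinite _)]
  ext π; simp

lemma ncard_cuts {A B : Finset ℕ} (hA : A ⊆ Finset.Ico 1 n) (hB : B ⊆ Finset.Ico 1 n)
    (hAB : Disjoint A B) :
    {π : Equiv.Perm (Fin n) | IsBRegular (b2 n) π ∧ A ⊆ cutSet π ∧ Disjoint B (cutSet π)}.ncard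
      = 2 ^ (n - 1 - B.card - A.card) := by
  rw [← (bijOn_cutSet A B).injOn.ncard_image, (bijOn_cutSet A B).image_eq, Set.ncard_coe_finset,
    Finset.card_Icc_finset (Finset.subset_sdiff.2 ⟨hA, hAB⟩),
    Finset.card_sdiff_of_subset hB, Nat.card_Ico]

/-- The cuts are independent fair coin tosses. -/
lemma unifB2_real_cuts {A B : Finset ℕ} (hA : A ⊆ Finset.Ico 1 n) (hB : B ⊆ Finset.Ico 1 n)
    (hAB : Disjoint A B) :
    (unifB2 n).real {π | (∀ j ∈ A, IsCut π j) ∧ ∀ j ∈ B, ¬ IsCut π j}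
      = (1 / 2) ^ (A.card + B.card) := by
  have hinter : {π : Equiv.Perm (Fin n) | IsBRegular (b2 n) π} ∩
      {π | (∀ j ∈ A, IsCut π j) ∧ ∀ j ∈ B, ¬ IsCut π j}
      = {π | IsBRegular (b2 n) π ∧ A ⊆ cutSet π ∧ Disjoint B (cutSet π)} := by
    ext π
    simp only [Set.mem_inter_iff, Set.mem_ofPred_eq, Finset.subset_iff, Finset.disjoint_left,
      mem_cutSet]
    refine and_congr_right fun _ => and_congr ?_ ?_
    · exact forall₂_congr fun j hj => by have := Finset.mem_Ico.1 (hA hj); tauto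
    · exact forall₂_congr fun j hj => by have := Finset.mem_Ico.1 (hB hj); tauto
  have htot : {π : Equiv.Perm (Fin n) | IsBRegular (b2 n) π}.ncard = 2 ^ (n - 1) := by
    have := ncard_cuts n (A := ∅) (B := ∅) (by simp) (by simp) (by simp)
    simpa using this
  have hcard : A.card + B.card ≤ n - 1 := by
    rw [← Finset.card_union_of_disjoint hAB]
    simpa using Finset.card_le_card (Finset.union_subset hA hB)
  rw [unifB2, uniformOn, Measure.real, cond_apply MeasurableSet.of_discrete, hinter,
    ENNReal.toReal_mul, ENNReal.toReal_inv, Measure.count_apply_finite _ (Set.toFinite _),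
    Measure.count_apply_finite _ (Set.toFinite _), ← Set.ncard_eq_toFinset_card,
    ← Set.ncard_eq_toFinset_card, htot, ncard_cuts n hA hB hAB]
  simp only [ENNReal.toReal_natCast]
  rw [inv_mul_eq_div, div_eq_iff (by positivity)]
  push_cast
  obtain ⟨m, hm⟩ := Nat.exists_eq_add_of_le hcard
  rw [show n - 1 - B.card - A.card = m by omega, hm, pow_add (2 : ℝ) (A.card + B.card), ← mul_assoc,
    ← mul_pow]
  norm_num

lemma iIndepSet_isCut : iIndepSet (fun j : ℕ => {π | IsCut π j}) (unifB2 n) := by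
  have hreal : ∀ t : Finset ℕ, (unifB2 n).real (⋂ j ∈ t, {π | IsCut π j})
      = (1 / 2) ^ (t ∩ Finset.Ico 1 n).card := by
    intro t
    have h := unifB2_real_cuts n (A := t ∩ Finset.Ico 1 n) (B := ∅) Finset.inter_subset_right
      (by simp) (by simp)
    rw [Finset.card_empty, add_zero] at h
    rw [← h]
    congr 1
    ext π
    simp only [Set.mem_iInter, Set.mem_ofPred_eq, Finset.mem_inter, Finset.mem_Ico,
      Finset.notMem_empty, false_imp_iff, implies_true, and_true]
    refine forall_congr' fun j => ?_
    rcases Nat.eq_zero_or_pos j with rfl | hj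
    · simp [isCut_zero]
    · rcases lt_or_ge j n with hjn | hjn
      · have : 1 ≤ j := hj
        tauto
      · simp [isCut_of_le _ hjn]
  rw [iIndepSet_iff_meas_biInter fun _ => MeasurableSet.of_discrete]
  intro t
  rw [← ENNReal.toReal_eq_toReal_iff' (measure_ne_top _ _)
    (ENNReal.prod_ne_top fun _ _ => measure_ne_top _ _), ENNReal.toReal_prod]
  change (unifB2 n).real _ = ∏ j ∈ t, (unifB2 n).real {π | IsCut π j}
  have h1 : ∀ j, (unifB2 n).real {π | IsCut π j} = if j ∈ Finset.Ico 1 n then 1 / 2 else 1 := by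
    intro j
    have := hreal {j}
    simp only [Finset.mem_singleton, Set.iInter_iInter_eq_left] at this
    rw [this, Finset.singleton_inter]
    split_ifs <;> simp
  simp_rw [hreal, h1]
  rw [Finset.prod_ite, Finset.prod_const, Finset.prod_const_one, mul_one,
    Finset.filter_mem_eq_inter]

variable {n}

/-- Functions of the cuts in two disjoint sets of positions are independent. -/
lemma indepFun_of_cuts {A B : Finset ℕ} (hAB : Disjoint A B) {φ ψ : Equiv.Perm (Fin n) → ℝ}
    (hφ : ∀ π ρ, (∀ j ∈ A, IsCut π j ↔ IsCut ρ j) → φ π = φ ρ)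
    (hψ : ∀ π ρ, (∀ j ∈ B, IsCut π j ↔ IsCut ρ j) → ψ π = ψ ρ) :
    IndepFun φ ψ (unifB2 n) := by
  classical
  have hind := (iIndepSet_isCut n).iIndepFun_indicator (β := ℕ) (m := ⊤)
  have h := hind.indepFun_finset A B hAB fun _ => Measurable.of_discrete
  -- `χ` factors through the tuple of the cut indicators in `D`
  have hfac : ∀ {D : Finset ℕ} {χ : Equiv.Perm (Fin n) → ℝ},
      (∀ π ρ, (∀ j ∈ D, IsCut π j ↔ IsCut ρ j) → χ π = χ ρ) →
      ∃ e : (D → ℕ) → ℝ, χ = e ∘ fun π (j : D) => ({π | IsCut π j} : Set _).indicator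
        (fun _ => (1 : ℕ)) π := by
    intro D χ hχ
    refine (Function.factorsThrough_iff χ).1 fun π ρ hπρ => hχ π ρ fun j hj => ?_
    have := congrFun hπρ ⟨j, hj⟩
    simp only [Set.indicator_apply, Set.mem_ofPred_eq] at this
    by_cases h1 : IsCut π j <;> by_cases h2 : IsCut ρ j <;> simp_all
  obtain ⟨e, rfl⟩ := hfac hφ
  obtain ⟨e', rfl⟩ := hfac hψ
  exact h.comp Measurable.of_discrete Measurable.of_discrete

end Law

/-! ### Cycles as blocks between consecutive cuts -/

section CycleCount

variable {n k : ℕ} {π : Equiv.Perm (Fin n)}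

/-- A cycle on the interval `[i, i + k)` is the cycle of its first point, and the interval is its
support. -/
lemma HasCycleAt.map_support_cycleOf {i : ℕ} (h : HasCycleAt k i π) (hk : 2 ≤ k)
    (hi : i + k ≤ n) :
    (π.cycleOf ⟨i, by omega⟩).support.map Fin.valEmbedding = Finset.Ico i (i + k) := by
  obtain ⟨h1, h2⟩ := h
  set x : Fin n := ⟨i, by omega⟩ with hx
  have hπx : (π x : ℕ) + 1 = i + k := h1 x rfl
  have hxs : x ∈ π.support := by
    rw [Equiv.Perm.mem_support]
    intro h
    rw [h] at hπx
    simp only [hx] at hπx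
    omega
  have hpow : ∀ m : ℕ, i ≤ ((π ^ m) x : ℕ) ∧ ((π ^ m) x : ℕ) < i + k := by
    intro m
    induction m with
    | zero => simp [hx]; omega
    | succ m ih =>
      rw [pow_succ', Equiv.Perm.mul_apply]
      rcases ih.1.eq_or_lt with h | h
      · have := h1 _ h.symm; omega
      · have := h2 _ h ih.2; omega
  have hsame : ∀ d : ℕ, ∀ y : Fin n, (y : ℕ) + 1 + d = i + k → i ≤ y → π.SameCycle x y := by
    intro d
    induction d with
    | zero =>
      intro y hy _
      have : y = π x := Fin.ext (by omega)
      rw [this, Equiv.Perm.sameCycle_apply_right]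
    | succ d ih =>
      intro y hy hiy
      have h3 := ih ⟨y + 1, by omega⟩ (by simp only; omega) (by simp only; omega)
      have h4 := h2 ⟨y + 1, by omega⟩ (by simp only; omega) (by simp only; omega)
      have : y = π ⟨y + 1, by omega⟩ := Fin.ext (by simp only at h4; omega)
      rw [this, Equiv.Perm.sameCycle_apply_right]
      exact h3
  ext j
  simp only [Finset.mem_map, Fin.valEmbedding_apply, Finset.mem_Ico,
    Equiv.Perm.mem_support_cycleOf_iff]
  constructor
  · rintro ⟨y, ⟨hy, -⟩, rfl⟩
    obtain ⟨m, -, hm⟩ := hy.exists_pow_eq'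
    rw [← hm]
    exact hpow m
  · rintro ⟨hij, hj⟩
    refine ⟨⟨j, by omega⟩, ⟨hsame (i + k - 1 - j) _ (by simp only; omega) hij, hxs⟩, rfl⟩

open Classical in
/-- All cycles of a `b₂`-regular permutation live on intervals. -/
lemma numCycles_eq_card (hπ : IsBRegular (b2 n) π) (hk : 1 ≤ k) (hkn : k ≤ n) :
    numCycles k π = ((Finset.range (n - k + 1)).filter fun i => HasCycleAt k i π).card := by
  rw [numCycles, Equiv.Perm.parts_partition, Multiset.count_add]
  rcases hk.eq_or_lt with rfl | hk
  · have h0 : π.cycleType.count 1 = 0 := by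
      rw [Multiset.count_eq_zero]
      intro h
      exact absurd (Equiv.Perm.one_lt_of_mem_cycleType h) (lt_irrefl 1)
    rw [h0, zero_add, Multiset.count_replicate_self, ← Finset.card_compl]
    refine Finset.card_bij (fun x _ => (x : ℕ)) ?_ ?_ ?_
    · intro x hx
      simp only [Finset.mem_compl, Equiv.Perm.mem_support, ne_eq, not_not] at hx
      rw [Finset.mem_filter, Finset.mem_range]
      refine ⟨by omega, fun y hy => ?_, fun y h1 h2 => by omega⟩
      rw [show y = x from Fin.ext hy, hx]
    · intro x _ y _ h
      exact Fin.ext h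
    · intro i hi
      rw [Finset.mem_filter, Finset.mem_range] at hi
      have hin : i < n := by omega
      refine ⟨⟨i, hin⟩, ?_, rfl⟩
      simp only [Finset.mem_compl, Equiv.Perm.mem_support, ne_eq, not_not]
      have := hi.2.1 ⟨i, hin⟩ rfl
      exact Fin.ext (by simp only; omega)
  · have h0 : (Multiset.replicate (Fintype.card (Fin n) - π.support.card) 1).count k = 0 := by
      rw [Multiset.count_replicate, if_neg (by omega)]
    rw [h0, add_zero, Equiv.Perm.cycleType_def, Multiset.count_map, ← Finset.filter_val,
      Finset.card_val]
    symm
    have hr : ∀ i, i ∈ (Finset.range (n - k + 1)).filter (fun i => HasCycleAt k i π) →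
        i + k ≤ n ∧ HasCycleAt k i π := by
      intro i hi
      rw [Finset.mem_filter, Finset.mem_range] at hi
      exact ⟨by omega, hi.2⟩
    refine Finset.card_bij (fun i hi => π.cycleOf ⟨i, by have := (hr i hi).1; omega⟩) ?_ ?_ ?_
    · intro i hi
      obtain ⟨hi, hc⟩ := hr i hi
      have hs := hc.map_support_cycleOf hk hi
      have hcard : (π.cycleOf ⟨i, by omega⟩).support.card = k := by
        rw [← Finset.card_map Fin.valEmbedding, hs]; simp
      rw [Finset.mem_filter]
      refine ⟨?_, hcard.symm⟩
      rw [Equiv.Perm.cycleOf_mem_cycleFactorsFinset_iff, Equiv.Perm.mem_support,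
        ← Equiv.Perm.support_cycleOf_nonempty,
        ← Finset.card_pos]
      omega
    · intro i hi j hj hij
      obtain ⟨hi, hci⟩ := hr i hi
      obtain ⟨hj, hcj⟩ := hr j hj
      have h1 := hci.map_support_cycleOf hk hi
      rw [hij, hcj.map_support_cycleOf hk hj] at h1
      have h2 : i ∈ Finset.Ico j (j + k) := by rw [h1, Finset.mem_Ico]; omega
      have h3 : j ∈ Finset.Ico i (i + k) := by rw [← h1, Finset.mem_Ico]; omega
      rw [Finset.mem_Ico] at h2 h3
      omega
    · intro c hc
      rw [Finset.mem_filter] at hc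
      obtain ⟨hc, hck⟩ := hc
      simp only [Function.comp_apply] at hck
      have hne : c.support.Nonempty := by rw [← Finset.card_pos]; omega
      -- the cycle starts at its smallest point
      set x := c.support.min' hne with hx
      have hxs : x ∈ c.support := Finset.min'_mem _ _
      have hcx : c = π.cycleOf x := Equiv.Perm.cycle_is_cycleOf hxs hc
      have hxs' := hxs
      rw [hcx, Equiv.Perm.mem_support_cycleOf_iff] at hxs'
      have hcut : IsCut π x := by
        by_contra hcon
        obtain ⟨y, hy, hy'⟩ := exists_of_not_isCut hπ hcon
        obtain rfl : y = x := Fin.ext hy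
        have h1 : π x ∈ c.support := by
          rw [hcx, Equiv.Perm.mem_support_cycleOf_iff, Equiv.Perm.sameCycle_apply_right]
          exact hxs'
        have h2 : (x : ℕ) ≤ π x := Finset.min'_le _ _ h1
        omega
      obtain ⟨l, hl, hln, -, -, hcyc⟩ := exists_hasCycleAt hπ x.2 hcut
      have hl2 : 2 ≤ l := by
        by_contra hlt
        have h1 := hcyc.1 x rfl
        exact Equiv.Perm.mem_support.1 hxs'.2 (Fin.ext (by omega))
      have hs := congrArg Finset.card (hcyc.map_support_cycleOf hl2 hln)
      rw [Finset.card_map, Nat.card_Ico, Fin.eta, ← hcx, ← hck] at hs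
      obtain rfl : l = k := by omega
      refine ⟨x, ?_, hcx.symm⟩
      rw [Finset.mem_filter, Finset.mem_range]
      exact ⟨by omega, hcyc⟩

end CycleCount

section Blocks

/-- `i` and `i + k` are consecutive cuts. -/
def IsBlock {n : ℕ} (k i : ℕ) (π : Equiv.Perm (Fin n)) : Prop :=
  (∀ j ∈ ({i, i + k} : Finset ℕ), IsCut π j) ∧ ∀ j ∈ Finset.Ioo i (i + k), ¬ IsCut π j

/-- The indicator of the event that `i` and `i + k` are consecutive cuts. It agrees with `cycInd`
on `b₂`-regular permutations, and depends on the cuts in `[i, i + k]` only. -/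
noncomputable def blockInd (n k i : ℕ) : Equiv.Perm (Fin n) → ℝ :=
  Set.indicator {π | IsBlock k i π} fun _ => 1

/-- The probability that `i` and `i + k` are consecutive cuts. -/
noncomputable def blockProb (n k i : ℕ) : ℝ := ∫ π, blockInd n k i π ∂(unifB2 n)

/-- The probability of a cut at `j`. -/
noncomputable def cutProb (n j : ℕ) : ℝ := if 1 ≤ j ∧ j < n then 1 / 2 else 1

variable {n k i : ℕ}

lemma isBlock_iff {π : Equiv.Perm (Fin n)} : IsBlock k i π ↔
    IsCut π i ∧ IsCut π (i + k) ∧ ∀ j, i < j → j < i + k → ¬ IsCut π j := by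
  simp [IsBlock, and_assoc]

lemma blockInd_eq_zero_or_one (n k i : ℕ) (π : Equiv.Perm (Fin n)) :
    blockInd n k i π = 0 ∨ blockInd n k i π = 1 := by
  by_cases h : IsBlock k i π <;> simp [blockInd, h]

lemma blockInd_nonneg (n k i : ℕ) (π : Equiv.Perm (Fin n)) : 0 ≤ blockInd n k i π := by
  rcases blockInd_eq_zero_or_one n k i π with h | h <;> simp [h]

lemma blockInd_le_one (n k i : ℕ) (π : Equiv.Perm (Fin n)) : blockInd n k i π ≤ 1 := by
  rcases blockInd_eq_zero_or_one n k i π with h | h <;> simp [h]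

lemma blockInd_sq (n k i : ℕ) (π : Equiv.Perm (Fin n)) :
    blockInd n k i π * blockInd n k i π = blockInd n k i π := by
  rcases blockInd_eq_zero_or_one n k i π with h | h <;> simp [h]

lemma cycInd_eq_blockInd {π : Equiv.Perm (Fin n)} (hπ : IsBRegular (b2 n) π) (hk : 1 ≤ k)
    (hi : i + k ≤ n) : cycInd n k i π = blockInd n k i π := by
  have h : HasCycleAt k i π ↔ IsBlock k i π := by rw [hasCycleAt_iff hπ hk hi, isBlock_iff]
  by_cases hc : IsBlock k i π <;> simp [cycInd, blockInd, h, hc]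

lemma numCycles_eq_sum {π : Equiv.Perm (Fin n)} (hπ : IsBRegular (b2 n) π) (hk : 1 ≤ k)
    (hkn : k ≤ n) :
    (numCycles k π : ℝ) = ∑ i ∈ Finset.range (n - k + 1), blockInd n k i π := by
  classical
  rw [numCycles_eq_card hπ hk hkn, Finset.card_filter, Nat.cast_sum]
  refine Finset.sum_congr rfl fun i hi => ?_
  rw [Finset.mem_range] at hi
  rw [← cycInd_eq_blockInd hπ hk (by omega)]
  by_cases hc : HasCycleAt k i π <;> simp [cycInd, hc]

lemma blockInd_congr {π ρ : Equiv.Perm (Fin n)} {s : Finset ℕ} (hs : Finset.Icc i (i + k) ⊆ s)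
    (h : ∀ j ∈ s, IsCut π j ↔ IsCut ρ j) : blockInd n k i π = blockInd n k i ρ := by
  have h' : ∀ j, i ≤ j → j ≤ i + k → (IsCut π j ↔ IsCut ρ j) :=
    fun j h1 h2 => h j (hs (Finset.mem_Icc.2 ⟨h1, h2⟩))
  have : IsBlock k i π ↔ IsBlock k i ρ := by
    rw [isBlock_iff, isBlock_iff, h' i le_rfl (by omega), h' (i + k) (by omega) le_rfl]
    refine and_congr_right fun _ => and_congr_right fun _ => forall_congr' fun j => ?_
    refine forall_congr' fun h1 => forall_congr' fun h2 => ?_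
    rw [h' j h1.le h2.le]
  by_cases hc : IsBlock k i ρ <;> simp [blockInd, this, hc]

/-- Two different blocks whose starting points are at distance less than `k` exclude each other. -/
lemma blockInd_mul_eq_zero {i j : ℕ} (hij : i < j) (hj : j < i + k) (π : Equiv.Perm (Fin n)) :
    blockInd n k i π * blockInd n k j π = 0 := by
  by_cases h1 : IsBlock k i π
  · have h2 : ¬ IsBlock k j π := fun h2 =>
      (isBlock_iff.1 h1).2.2 j hij hj (isBlock_iff.1 h2).1
    simp [blockInd, h2]
  · simp [blockInd, h1]

/-- At most one block starts in a set of diameter less than `k`. -/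
lemma sum_blockInd_le_one {s : Finset ℕ} (hs : ∀ i ∈ s, ∀ j ∈ s, i < j + k)
    (π : Equiv.Perm (Fin n)) : ∑ i ∈ s, blockInd n k i π ≤ 1 := by
  by_cases h : ∃ i ∈ s, blockInd n k i π = 1
  · obtain ⟨i, hi, h1⟩ := h
    rw [Finset.sum_eq_single_of_mem i hi, h1]
    intro j hj hji
    rcases lt_or_gt_of_ne hji with h2 | h2
    · have := blockInd_mul_eq_zero h2 (hs i hi j hj) π
      simpa [h1] using this
    · have := blockInd_mul_eq_zero h2 (hs j hj i hi) π
      simpa [h1] using this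
  · push Not at h
    rw [Finset.sum_eq_zero fun i hi => (blockInd_eq_zero_or_one n k i π).resolve_right (h i hi)]
    exact zero_le_one

/-- The positions in `A` may lie outside `[1, n)`, where a cut is certain. -/
lemma integral_cuts {A B : Finset ℕ} (hB : B ⊆ Finset.Ico 1 n) (hAB : Disjoint A B) :
    ∫ π : Equiv.Perm (Fin n), Set.indicator {π | (∀ j ∈ A, IsCut π j) ∧ ∀ j ∈ B, ¬ IsCut π j}
      (fun _ => (1 : ℝ)) π ∂(unifB2 n) = (∏ j ∈ A, cutProb n j) * (1 / 2) ^ B.card := by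
  have hset : {π : Equiv.Perm (Fin n) | (∀ j ∈ A, IsCut π j) ∧ ∀ j ∈ B, ¬ IsCut π j}
      = {π | (∀ j ∈ A ∩ Finset.Ico 1 n, IsCut π j) ∧ ∀ j ∈ B, ¬ IsCut π j} := by
    ext π
    simp only [Set.mem_ofPred_eq, Finset.mem_inter, Finset.mem_Ico]
    refine and_congr_left fun _ => forall_congr' fun j => ?_
    rcases Nat.eq_zero_or_pos j with rfl | hj
    · simp [isCut_zero]
    · rcases lt_or_ge j n with hjn | hjn
      · have : 1 ≤ j := hj
        tauto
      · simp [isCut_of_le _ hjn]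
  rw [integral_indicator_const _ MeasurableSet.of_discrete, smul_eq_mul, mul_one, hset,
    unifB2_real_cuts n Finset.inter_subset_right hB
    (hAB.mono_left Finset.inter_subset_left), pow_add]
  congr 1
  simp only [cutProb, ← Finset.mem_Ico]
  rw [Finset.prod_ite, Finset.prod_const, Finset.prod_const_one, mul_one,
    Finset.filter_mem_eq_inter]

lemma cutProb_of_lt {j : ℕ} (h1 : 1 ≤ j) (h2 : j < n) : cutProb n j = 1 / 2 := if_pos ⟨h1, h2⟩

@[simp] lemma cutProb_zero (n : ℕ) : cutProb n 0 = 1 := if_neg (by omega)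

@[simp] lemma cutProb_self (n : ℕ) : cutProb n n = 1 := if_neg (by omega)

lemma cutProb_pos (n j : ℕ) : 0 < cutProb n j := by unfold cutProb; split_ifs <;> norm_num

lemma blockProb_eq (hk : 1 ≤ k) (hi : i + k ≤ n) :
    blockProb n k i = cutProb n i * cutProb n (i + k) * (1 / 2) ^ (k - 1) := by
  have h := integral_cuts (n := n) (A := {i, i + k}) (B := Finset.Ioo i (i + k))
    (fun j hj => by rw [Finset.mem_Ioo] at hj; rw [Finset.mem_Ico]; omega)
    (by rw [Finset.disjoint_left]; intro j hj; simp at hj ⊢; omega)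
  rw [Finset.prod_pair (by omega), Nat.card_Ioo, show i + k - i - 1 = k - 1 by omega] at h
  exact h

lemma blockProb_nonneg (n k i : ℕ) : 0 ≤ blockProb n k i :=
  integral_nonneg fun π => blockInd_nonneg n k i π

lemma blockProb_le_one (n k i : ℕ) : blockProb n k i ≤ 1 := by
  have := integral_mono (μ := unifB2 n) .of_finite (integrable_const 1) (blockInd_le_one n k i)
  simpa [blockProb] using this

lemma blockProb_pos (hk : 1 ≤ k) (hi : i + k ≤ n) : 0 < blockProb n k i := by
  rw [blockProb_eq hk hi]
  have := cutProb_pos n i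
  have := cutProb_pos n (i + k)
  positivity

/-- Two adjacent blocks share one cut, so their probabilities multiply up to a factor `2`. -/
lemma integral_blockInd_mul_adjacent (hk : 1 ≤ k) (hi : i + k + k ≤ n) :
    ∫ π, blockInd n k i π * blockInd n k (i + k) π ∂(unifB2 n)
      = 2 * (blockProb n k i * blockProb n k (i + k)) := by
  classical
  have h := integral_cuts (n := n) (A := {i, i + k, i + k + k})
    (B := Finset.Ioo i (i + k) ∪ Finset.Ioo (i + k) (i + k + k))
    (fun j hj => by
      rw [Finset.mem_union, Finset.mem_Ioo, Finset.mem_Ioo] at hj; rw [Finset.mem_Ico]; omega)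
    (by rw [Finset.disjoint_left]; intro j hj; simp at hj ⊢; omega)
  have hmul : ∀ π : Equiv.Perm (Fin n), blockInd n k i π * blockInd n k (i + k) π
      = Set.indicator {π | (∀ j ∈ ({i, i + k, i + k + k} : Finset ℕ), IsCut π j) ∧
          ∀ j ∈ Finset.Ioo i (i + k) ∪ Finset.Ioo (i + k) (i + k + k), ¬ IsCut π j}
        (fun _ => (1 : ℝ)) π := by
    intro π
    have hiff : ((∀ j ∈ ({i, i + k, i + k + k} : Finset ℕ), IsCut π j) ∧
          ∀ j ∈ Finset.Ioo i (i + k) ∪ Finset.Ioo (i + k) (i + k + k), ¬ IsCut π j)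
        ↔ IsBlock k i π ∧ IsBlock k (i + k) π := by
      simp only [IsBlock, Finset.mem_insert, Finset.mem_singleton, Finset.mem_union,
        forall_eq, or_imp, forall_and]
      tauto
    simp only [blockInd, Set.indicator, Set.mem_ofPred_eq, hiff]
    by_cases h1 : IsBlock k i π <;> by_cases h2 : IsBlock k (i + k) π <;> simp [h1, h2]
  simp_rw [hmul]
  rw [h, blockProb_eq hk (by omega), blockProb_eq hk hi,
    Finset.prod_insert (by simp; omega), Finset.prod_pair (by omega),
    Finset.card_union_of_disjoint (by
      rw [Finset.disjoint_left]; intro j hj; simp at hj ⊢; omega),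
    Nat.card_Ioo, Nat.card_Ioo, show i + k - i - 1 = k - 1 by omega,
    show i + k + k - (i + k) - 1 = k - 1 by omega, pow_add,
    cutProb_of_lt (n := n) (j := i + k) (by omega) (by omega)]
  ring

end Blocks

/-! ### Moments, dependence and the variance -/

section Moments

/-- The centred block indicator. -/
noncomputable def centredBlock (n k i : ℕ) (π : Equiv.Perm (Fin n)) : ℝ :=
  blockInd n k i π - blockProb n k i

variable {n k i : ℕ}

lemma integral_cycInd (hk : 1 ≤ k) (hi : i + k ≤ n) :
    ∫ π, cycInd n k i π ∂(unifB2 n) = blockProb n k i := by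
  refine integral_congr_ae ?_
  filter_upwards [ae_isBRegular n] with π hπ
  exact cycInd_eq_blockInd hπ hk hi

lemma X_eq_centredBlock {π : Equiv.Perm (Fin n)} (hπ : IsBRegular (b2 n) π) (hk : 1 ≤ k)
    (hi : i + k ≤ n) : X n k i π = centredBlock n k i π := by
  rw [X, centredBlock, integral_cycInd hk hi, cycInd_eq_blockInd hπ hk hi]

lemma integral_comp_blockInd (n k i : ℕ) (g : ℝ → ℝ) :
    ∫ π, g (blockInd n k i π) ∂(unifB2 n)
      = blockProb n k i * g 1 + (1 - blockProb n k i) * g 0 := by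
  have h : ∀ π, g (blockInd n k i π) = g 0 + blockInd n k i π * (g 1 - g 0) := by
    intro π
    rcases blockInd_eq_zero_or_one n k i π with h | h <;> simp [h]
  simp_rw [h]
  rw [integral_add .of_finite .of_finite, integral_mul_const, ← blockProb]
  simp
  ring

lemma integral_centredBlock (n k i : ℕ) : ∫ π, centredBlock n k i π ∂(unifB2 n) = 0 := by
  have := integral_comp_blockInd n k i fun x => x - blockProb n k i
  simp only [centredBlock]
  rw [this]; ring

lemma integral_abs_centredBlock (n k i : ℕ) : ∫ π, |centredBlock n k i π| ∂(unifB2 n)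
    = 2 * (blockProb n k i * (1 - blockProb n k i)) := by
  have := integral_comp_blockInd n k i fun x => |x - blockProb n k i|
  simp only [centredBlock]
  rw [this, abs_of_nonneg (sub_nonneg.2 (blockProb_le_one n k i)), zero_sub, abs_neg,
    abs_of_nonneg (blockProb_nonneg n k i)]
  ring

lemma integral_abs_centredBlock_pow_three (n k i : ℕ) :
    ∫ π, |centredBlock n k i π| ^ 3 ∂(unifB2 n) = blockProb n k i * (1 - blockProb n k i) *
      (1 - 2 * blockProb n k i + 2 * blockProb n k i ^ 2) := by
  have := integral_comp_blockInd n k i fun x => |x - blockProb n k i| ^ 3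
  simp only [centredBlock]
  rw [this, abs_of_nonneg (sub_nonneg.2 (blockProb_le_one n k i)), zero_sub, abs_neg,
    abs_of_nonneg (blockProb_nonneg n k i)]
  ring

lemma integral_centredBlock_pow_four (n k i : ℕ) :
    ∫ π, centredBlock n k i π ^ 4 ∂(unifB2 n) = blockProb n k i * (1 - blockProb n k i) *
      (1 - 3 * blockProb n k i + 3 * blockProb n k i ^ 2) := by
  have := integral_comp_blockInd n k i fun x => (x - blockProb n k i) ^ 4
  simp only [centredBlock]
  rw [this]
  ring

lemma aSum_eq (hk : 1 ≤ k) (hkn : k ≤ n) : aSum n k = ∑ i ∈ Finset.range (n - k + 1),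
    ∫ π, |centredBlock n k i π| ^ 3 ∂(unifB2 n) := by
  refine Finset.sum_congr rfl fun i hi => integral_congr_ae ?_
  filter_upwards [ae_isBRegular n] with π hπ
  rw [Finset.mem_range] at hi
  rw [X_eq_centredBlock hπ hk (by omega)]

lemma bSum_eq (hk : 1 ≤ k) (hkn : k ≤ n) : bSum n k = ∑ i ∈ Finset.range (n - k + 1),
    ∫ π, centredBlock n k i π ^ 4 ∂(unifB2 n) := by
  refine Finset.sum_congr rfl fun i hi => integral_congr_ae ?_
  filter_upwards [ae_isBRegular n] with π hπ
  rw [Finset.mem_range] at hi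
  rw [X_eq_centredBlock hπ hk (by omega)]

lemma sigmaSq_eq (hk : 1 ≤ k) (hkn : k ≤ n) : sigmaSq n k
    = ∫ π, (∑ i ∈ Finset.range (n - k + 1), centredBlock n k i π) ^ 2 ∂(unifB2 n) := by
  have hae : (fun π : Equiv.Perm (Fin n) => (numCycles k π : ℝ)) =ᵐ[unifB2 n]
      fun π => ∑ i ∈ Finset.range (n - k + 1), blockInd n k i π := by
    filter_upwards [ae_isBRegular n] with π hπ
    exact numCycles_eq_sum hπ hk hkn
  rw [sigmaSq, variance_congr hae, variance_eq_integral Measurable.of_discrete.aemeasurable]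
  refine integral_congr_ae (ae_of_all _ fun π => ?_)
  simp only [centredBlock, Finset.sum_sub_distrib, blockProb]
  rw [integral_finsetSum _ fun _ _ => .of_finite]

/-- The two blocks at the ends of `[0, n)` need one random cut only, all other blocks need two. -/
lemma blockProb_eq_ite (hk : 1 ≤ k) (hkn : k < n) (hi : i + k ≤ n) :
    blockProb n k i = if i = 0 ∨ i = n - k then 1 / 2 ^ k else 1 / 2 ^ (k + 1) := by
  obtain ⟨m, rfl⟩ := Nat.exists_eq_add_of_le' hk
  rw [blockProb_eq hk hi, Nat.add_sub_cancel]
  rcases eq_or_ne i 0 with rfl | h0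
  · rw [if_pos (Or.inl rfl), cutProb_zero, cutProb_of_lt (by omega) (by omega), one_div_pow]
    ring
  · rcases eq_or_ne i (n - (m + 1)) with h1 | h1
    · rw [if_pos (Or.inr h1), cutProb_of_lt (by omega) (by omega),
        show i + (m + 1) = n by omega, cutProb_self, one_div_pow]
      ring
    · rw [if_neg (by tauto), cutProb_of_lt (by omega) (by omega),
        cutProb_of_lt (by omega) (by omega), one_div_pow]
      ring

lemma sum_comp_blockProb (hk : 1 ≤ k) (hkn : k < n) (G : ℝ → ℝ) :
    ∑ i ∈ Finset.range (n - k + 1), G (blockProb n k i)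
      = 2 * G (1 / 2 ^ k) + ((n : ℝ) - k - 1) * G (1 / 2 ^ (k + 1)) := by
  obtain ⟨m, rfl⟩ := Nat.exists_eq_add_of_lt hkn
  rw [show k + m + 1 - k + 1 = m + 1 + 1 by omega, Finset.sum_range_succ, Finset.sum_range_succ',
    blockProb_eq_ite hk hkn (by omega), if_pos (Or.inl rfl),
    blockProb_eq_ite hk hkn (by omega), if_pos (Or.inr (by omega))]
  have h : ∀ i ∈ Finset.range m, G (blockProb (k + m + 1) k (i + 1)) = G (1 / 2 ^ (k + 1)) := by
    intro i hi
    rw [Finset.mem_range] at hi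
    rw [blockProb_eq_ite hk hkn (by omega), if_neg (by omega)]
  rw [Finset.sum_congr rfl h, Finset.sum_const, Finset.card_range, nsmul_eq_mul]
  push_cast
  ring

lemma aSum_formula (hk : 1 ≤ k) (hkn : k < n) : aSum n k
    = 2 * (((2 : ℝ) ^ (3 * k) - 3 * 2 ^ (2 * k) + 2 ^ (k + 2) - 2) / 2 ^ (4 * k))
      + ((n : ℝ) - k - 1) *
        (((2 : ℝ) ^ (3 * (k + 1)) - 3 * 2 ^ (2 * (k + 1)) + 2 ^ (k + 3) - 2)
          / 2 ^ (4 * (k + 1))) := by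
  rw [aSum_eq hk hkn.le]
  simp_rw [integral_abs_centredBlock_pow_three]
  rw [sum_comp_blockProb hk hkn fun p => p * (1 - p) * (1 - 2 * p + 2 * p ^ 2)]
  have h : ∀ m : ℕ, (1 / 2 ^ m : ℝ) * (1 - 1 / 2 ^ m) * (1 - 2 * (1 / 2 ^ m) + 2 * (1 / 2 ^ m) ^ 2)
      = ((2 : ℝ) ^ (3 * m) - 3 * 2 ^ (2 * m) + 2 ^ (m + 2) - 2) / 2 ^ (4 * m) := by
    intro m
    rw [mul_comm 3 m, mul_comm 2 m, mul_comm 4 m, pow_mul, pow_mul, pow_mul, pow_add]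
    field_simp
    ring
  simp only [h]

lemma bSum_formula (hk : 1 ≤ k) (hkn : k < n) : bSum n k
    = 2 * (((2 : ℝ) ^ (2 * k) - 3 * 2 ^ k + 3) * (2 ^ k - 1) / 2 ^ (4 * k))
      + ((n : ℝ) - k - 1) *
        (((2 : ℝ) ^ (2 * (k + 1)) - 3 * 2 ^ (k + 1) + 3) * (2 ^ (k + 1) - 1)
          / 2 ^ (4 * (k + 1))) := by
  rw [bSum_eq hk hkn.le]
  simp_rw [integral_centredBlock_pow_four]
  rw [sum_comp_blockProb hk hkn fun p => p * (1 - p) * (1 - 3 * p + 3 * p ^ 2)]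
  have h : ∀ m : ℕ, (1 / 2 ^ m : ℝ) * (1 - 1 / 2 ^ m) * (1 - 3 * (1 / 2 ^ m) + 3 * (1 / 2 ^ m) ^ 2)
      = ((2 : ℝ) ^ (2 * m) - 3 * 2 ^ m + 3) * (2 ^ m - 1) / 2 ^ (4 * m) := by
    intro m
    rw [mul_comm 2 m, mul_comm 4, pow_mul, pow_mul]
    field_simp
  simp only [h]

end Moments

section Dependence

variable {n k i j : ℕ}

lemma centredBlock_congr {π ρ : Equiv.Perm (Fin n)} {s : Finset ℕ}
    (hs : Finset.Icc i (i + k) ⊆ s) (h : ∀ j ∈ s, IsCut π j ↔ IsCut ρ j) :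
    centredBlock n k i π = centredBlock n k i ρ := by
  rw [centredBlock, centredBlock, blockInd_congr hs h]

lemma nbrSum_centredBlock_congr {N : ℕ} {π ρ : Equiv.Perm (Fin n)}
    (h : ∀ j ∈ Finset.Icc (i - k) (i + 2 * k), IsCut π j ↔ IsCut ρ j) :
    nbrSum (centredBlock n k) N k i π = nbrSum (centredBlock n k) N k i ρ := by
  refine Finset.sum_congr rfl fun j hj => centredBlock_congr ?_ h
  rw [mem_nbr] at hj
  exact Finset.Icc_subset_Icc (by omega) (by omega)

lemma indepFun_centredBlock_of_lt (h : i + k < j) :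
    IndepFun (centredBlock n k i) (centredBlock n k j) (unifB2 n) := by
  refine indepFun_of_cuts (A := Finset.Icc i (i + k)) (B := Finset.Icc j (j + k)) ?_
    (fun _ _ => centredBlock_congr subset_rfl) (fun _ _ => centredBlock_congr subset_rfl)
  rw [Finset.disjoint_left]; intro l; simp only [Finset.mem_Icc]; omega

lemma indepFun_centredBlock_sum (hkn : k ≤ n) (hi : i < n - k + 1) :
    IndepFun (centredBlock n k i) (fun π => ∑ j ∈ (Finset.range (n - k + 1)).filter
      (fun j => j ∉ nbr (n - k + 1) k i), centredBlock n k j π) (unifB2 n) := by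
  refine indepFun_of_cuts (A := Finset.Icc i (i + k))
    (B := Finset.range (n + 1) \ Finset.Icc i (i + k)) Finset.disjoint_sdiff
    (fun _ _ => centredBlock_congr subset_rfl) fun π ρ h => ?_
  refine Finset.sum_congr rfl fun j hj => centredBlock_congr ?_ h
  rw [Finset.mem_filter, mem_nbr, Finset.mem_range] at hj
  intro l hl
  rw [Finset.mem_Icc] at hl
  rw [Finset.mem_sdiff, Finset.mem_range, Finset.mem_Icc]
  omega

/-- The product of `centredBlock n k i` with its neighbourhood sum is a function of the cuts in
`[i - k, i + 2 k]`. -/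
lemma indepFun_mul_nbrSum (N : ℕ) (h : i + 3 * k < j) :
    IndepFun (fun π => centredBlock n k i π * nbrSum (centredBlock n k) N k i π)
      (fun π => centredBlock n k j π * nbrSum (centredBlock n k) N k j π) (unifB2 n) := by
  have hdep : ∀ l : ℕ, ∀ π ρ : Equiv.Perm (Fin n),
      (∀ m ∈ Finset.Icc (l - k) (l + 2 * k), IsCut π m ↔ IsCut ρ m) →
      centredBlock n k l π * nbrSum (centredBlock n k) N k l π
        = centredBlock n k l ρ * nbrSum (centredBlock n k) N k l ρ := by
    intro l π ρ h
    rw [centredBlock_congr (Finset.Icc_subset_Icc (by omega) (by omega)) h,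
      nbrSum_centredBlock_congr h]
  refine indepFun_of_cuts (A := Finset.Icc (i - k) (i + 2 * k))
    (B := Finset.Icc (j - k) (j + 2 * k)) ?_ (hdep i) (hdep j)
  rw [Finset.disjoint_left]; intro l; simp only [Finset.mem_Icc]; omega

lemma integral_centredBlock_mul (n k i j : ℕ) :
    ∫ π, centredBlock n k i π * centredBlock n k j π ∂(unifB2 n)
      = ∫ π, blockInd n k i π * blockInd n k j π ∂(unifB2 n)
        - blockProb n k i * blockProb n k j := by
  have h : ∀ π, centredBlock n k i π * centredBlock n k j π
      = blockInd n k i π * blockInd n k j π - blockProb n k j * blockInd n k i π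
        - blockProb n k i * centredBlock n k j π := fun π => by simp only [centredBlock]; ring
  simp_rw [h]
  rw [integral_sub .of_finite .of_finite, integral_sub .of_finite .of_finite, integral_const_mul,
    integral_const_mul, integral_centredBlock, ← blockProb]
  ring

lemma integral_centredBlock_sq (n k i : ℕ) :
    ∫ π, centredBlock n k i π * centredBlock n k i π ∂(unifB2 n)
      = blockProb n k i - blockProb n k i * blockProb n k i := by
  rw [integral_centredBlock_mul]
  simp_rw [blockInd_sq]
  rfl

lemma integral_centredBlock_mul_of_lt {d : ℕ} (hd : 0 < d) (hdk : d < k) :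
    ∫ π, centredBlock n k i π * centredBlock n k (i + d) π ∂(unifB2 n)
      = -(blockProb n k i * blockProb n k (i + d)) := by
  rw [integral_centredBlock_mul]
  simp_rw [blockInd_mul_eq_zero (show i < i + d by omega) (show i + d < i + k by omega)]
  simp

lemma integral_centredBlock_mul_adjacent (hk : 1 ≤ k) (hi : i + k + k ≤ n) :
    ∫ π, centredBlock n k i π * centredBlock n k (i + k) π ∂(unifB2 n)
      = blockProb n k i * blockProb n k (i + k) := by
  rw [integral_centredBlock_mul, integral_blockInd_mul_adjacent hk hi]
  ring

lemma integral_centredBlock_mul_of_gt {d : ℕ} (hdk : k < d) :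
    ∫ π, centredBlock n k i π * centredBlock n k (i + d) π ∂(unifB2 n) = 0 := by
  have h := indepFun_centredBlock_of_lt (n := n) (k := k) (i := i) (j := i + d) (by omega)
  rw [h.integral_fun_mul_eq_mul_integral Measurable.of_discrete.aestronglyMeasurable
    Measurable.of_discrete.aestronglyMeasurable, integral_centredBlock, zero_mul]

end Dependence

section Variance

/-- A symmetric double sum, arranged by diagonals. -/
lemma sum_sum_eq_sum_diagonals (N : ℕ) {F : ℕ → ℕ → ℝ} (hF : ∀ i j, F i j = F j i) :
    ∑ i ∈ Finset.range N, ∑ j ∈ Finset.range N, F i j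
      = 2 * ∑ d ∈ Finset.range N, ∑ i ∈ Finset.range (N - d), F i (i + d)
        - ∑ i ∈ Finset.range N, F i i := by
  have h1 : ∀ M : ℕ, ∑ i ∈ Finset.range M, ∑ j ∈ Finset.range M, F i j
      = 2 * ∑ m ∈ Finset.range M, ∑ i ∈ Finset.range (m + 1), F i m
        - ∑ i ∈ Finset.range M, F i i := by
    intro M
    induction M with
    | zero => simp
    | succ M ih =>
      rw [Finset.sum_range_succ, Finset.sum_range_succ _ M, Finset.sum_range_succ (fun i => F i i)]
      simp_rw [Finset.sum_range_succ (fun j => F _ j)]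
      rw [Finset.sum_add_distrib, ih, Finset.sum_range_succ _ M,
        Finset.sum_range_succ (fun i => F i M), Finset.sum_congr rfl fun j _ => hF M j]
      ring
  have h2 := Finset.sum_range_diag_flip N fun i d => F i (i + d)
  have h3 : ∑ m ∈ Finset.range N, ∑ i ∈ Finset.range (m + 1), F i (i + (m - i))
      = ∑ m ∈ Finset.range N, ∑ i ∈ Finset.range (m + 1), F i m := by
    refine Finset.sum_congr rfl fun m _ => Finset.sum_congr rfl fun i hi => ?_
    rw [Finset.mem_range] at hi
    rw [show i + (m - i) = m by omega]
  rw [h1, ← h3, h2]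
  congr 2
  refine Finset.sum_comm' fun i d => ?_
  simp only [Finset.mem_range]; omega

variable {n k : ℕ}

/-- Only the two boundary blocks have a larger probability, and for `1 ≤ d ≤ k` they do not meet
in one product. -/
lemma sum_blockProb_mul_blockProb {d : ℕ} (hk : 1 ≤ k) (hkn : 2 * k < n) (hd : 1 ≤ d)
    (hdk : d ≤ k) : ∑ i ∈ Finset.range (n - k + 1 - d), blockProb n k i * blockProb n k (i + d)
      = (1 / 2 ^ (k + 1)) ^ 2 * ((n : ℝ) - k + 3 - d) := by
  obtain ⟨m, hm⟩ : ∃ m, n - k + 1 - d = m + 1 + 1 := ⟨n - k + 1 - d - 2, by omega⟩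
  have hlt : k < n := by omega
  have h : ∀ i ∈ Finset.range m, blockProb n k (i + 1) * blockProb n k (i + 1 + d)
      = (1 / 2 ^ (k + 1)) ^ 2 := by
    intro i hi
    rw [Finset.mem_range] at hi
    rw [blockProb_eq_ite hk hlt (by omega), if_neg (by omega),
      blockProb_eq_ite hk hlt (by omega), if_neg (by omega)]
    ring
  rw [hm, Finset.sum_range_succ, Finset.sum_range_succ', Finset.sum_congr rfl h, Finset.sum_const,
    Finset.card_range, nsmul_eq_mul, blockProb_eq_ite hk hlt (by omega), if_pos (Or.inl rfl),
    blockProb_eq_ite hk hlt (by omega), if_neg (by omega),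
    blockProb_eq_ite hk hlt (by omega), if_neg (by omega),
    blockProb_eq_ite hk hlt (by omega), if_pos (Or.inr (by omega))]
  have hn : (n : ℝ) = m + 1 + d + k := by
    have : n = m + 1 + d + k := by omega
    exact_mod_cast this
  rw [hn, pow_succ]
  field_simp
  ring

lemma sum_range_const_sub (c : ℝ) (K : ℕ) :
    ∑ d ∈ Finset.range K, (c - (d + 1 : ℕ)) = K * c - K * (K + 1) / 2 := by
  induction K with
  | zero => simp
  | succ K ih => rw [Finset.sum_range_succ, ih]; push_cast; ring

lemma sigmaSq_formula (hk : 1 ≤ k) (hkn : 2 * k < n) : sigmaSq n k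
    = (((2 : ℝ) ^ (k + 1) - 2 * k + 3) * n + 3 * k * ((k : ℝ) - 4)
        + (3 - (k : ℝ)) * 2 ^ (k + 1) + 5) / 4 ^ (k + 1) := by
  set N := n - k + 1 with hN
  set F : ℕ → ℕ → ℝ := fun i j => ∫ π, centredBlock n k i π * centredBlock n k j π ∂(unifB2 n)
    with hF
  set q : ℝ := 1 / 2 ^ (k + 1) with hq
  have hsum : sigmaSq n k = ∑ i ∈ Finset.range N, ∑ j ∈ Finset.range N, F i j := by
    rw [sigmaSq_eq hk (by omega)]
    simp_rw [sq, Finset.sum_mul_sum]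
    rw [integral_finsetSum _ fun _ _ => .of_finite]
    exact Finset.sum_congr rfl fun i _ => integral_finsetSum _ fun _ _ => .of_finite
  have hdiag : ∑ i ∈ Finset.range N, F i i = 2 * (2 * q - (2 * q) * (2 * q))
      + ((n : ℝ) - k - 1) * (q - q * q) := by
    have h1 : ∀ i, F i i = (fun p => p - p * p) (blockProb n k i) :=
      fun i => integral_centredBlock_sq n k i
    simp_rw [h1]
    rw [sum_comp_blockProb hk (by omega) fun p => p - p * p,
      show (1 / 2 ^ k : ℝ) = 2 * q by rw [hq, pow_succ]; field_simp]
  have hnear : ∀ d ∈ Finset.range (k - 1), ∑ i ∈ Finset.range (N - (d + 1)), F i (i + (d + 1))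
      = -q ^ 2 * ((n : ℝ) - k + 3 - (d + 1 : ℕ)) := by
    intro d hd
    rw [Finset.mem_range] at hd
    rw [neg_mul, ← sum_blockProb_mul_blockProb hk hkn (by omega) (by omega),
      ← Finset.sum_neg_distrib]
    exact Finset.sum_congr rfl fun i _ => integral_centredBlock_mul_of_lt (by omega) (by omega)
  have hadj : ∑ i ∈ Finset.range (N - k), F i (i + k) = q ^ 2 * ((n : ℝ) - k + 3 - k) := by
    rw [← sum_blockProb_mul_blockProb hk hkn hk le_rfl]
    refine Finset.sum_congr rfl fun i hi => ?_
    rw [Finset.mem_range] at hi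
    exact integral_centredBlock_mul_adjacent hk (by omega)
  have hall : ∑ d ∈ Finset.range N, ∑ i ∈ Finset.range (N - d), F i (i + d)
      = ∑ i ∈ Finset.range N, F i i
        + ∑ d ∈ Finset.range (k - 1), ∑ i ∈ Finset.range (N - (d + 1)), F i (i + (d + 1))
        + ∑ i ∈ Finset.range (N - k), F i (i + k) := by
    have h1 : Finset.range (k + 1) ⊆ Finset.range N :=
      Finset.range_subset_range.2 (by omega)
    rw [← Finset.sum_subset h1 fun d _ hd => ?_]
    · rw [Finset.sum_range_succ]
      obtain ⟨l, rfl⟩ := Nat.exists_eq_add_of_le' hk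
      rw [Finset.sum_range_succ', Nat.add_sub_cancel, Nat.sub_zero]
      simp only [add_zero]
      ring
    · rw [Finset.mem_range, not_lt] at hd
      exact Finset.sum_eq_zero fun i _ => integral_centredBlock_mul_of_gt (by omega)
  rw [hsum, sum_sum_eq_sum_diagonals N (fun i j => by simp only [hF, mul_comm]), hall, hadj,
    Finset.sum_congr rfl hnear, ← Finset.mul_sum, sum_range_const_sub, hdiag, Nat.cast_sub hk,
    show (4 : ℝ) = 2 ^ 2 by norm_num, ← pow_mul, mul_comm 2 (k + 1), pow_mul, hq]
  field_simp
  push_cast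
  ring

lemma sigmaSq_pos (hk : 1 ≤ k) (hn : 2 ≤ n) (hkn : k ≤ n) : 0 < sigmaSq n k := by
  rw [sigmaSq_eq hk hkn, integral_pos_iff_support_of_nonneg (fun π => sq_nonneg _) .of_finite]
  -- a permutation without `k`-cycles: no cuts if `k = 1`, all cuts otherwise
  obtain ⟨π, hπ, hcut⟩ := exists_isBRegular_isCut_iff n {_j | 2 ≤ k}
  have hzero : ∀ i ∈ Finset.range (n - k + 1), blockInd n k i π = 0 := by
    intro i hi
    rw [Finset.mem_range] at hi
    refine (blockInd_eq_zero_or_one n k i π).resolve_right fun h => ?_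
    have hb : IsBlock k i π := by
      by_contra hb
      simp [blockInd, hb] at h
    rw [isBlock_iff] at hb
    rcases hk.eq_or_lt with rfl | hk
    · rcases Nat.eq_zero_or_pos i with rfl | hi0
      · have := (hcut 1 le_rfl (by omega)).1 (by simpa using hb.2.1)
        simp at this
      · have := (hcut i hi0 (by omega)).1 hb.1
        simp at this
    · exact hb.2.2 (i + 1) (by omega) (by omega) ((hcut (i + 1) (by omega) (by omega)).2 hk)
  have hneg : ∑ i ∈ Finset.range (n - k + 1), centredBlock n k i π < 0 := by
    refine Finset.sum_neg (fun i hi => ?_) ⟨0, by simp⟩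
    rw [centredBlock, hzero i hi, zero_sub, neg_lt_zero]
    rw [Finset.mem_range] at hi
    exact blockProb_pos hk (by omega)
  have hmem : π ∈ Function.support
      fun π => (∑ i ∈ Finset.range (n - k + 1), centredBlock n k i π) ^ 2 :=
    pow_ne_zero 2 hneg.ne
  refine (pos_iff_ne_zero.2 fun h => ?_ : 0 < unifB2 n {π}).trans_le
    (measure_mono (Set.singleton_subset_iff.2 hmem))
  rw [unifB2, uniformOn_eq_zero_iff (Set.toFinite _)] at h
  exact (Set.ext_iff.1 h π).1 ⟨hπ, rfl⟩

end Variance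

/-! ### The cubic error term -/

section CubicTerm

variable {n k i : ℕ}

/-- At most `m` blocks start in an interval of length `m * k`. -/
lemma sum_blockInd_le {a m : ℕ} {s : Finset ℕ} (hs : s ⊆ Finset.Ico a (a + m * k))
    (π : Equiv.Perm (Fin n)) : ∑ j ∈ s, blockInd n k j π ≤ m := by
  induction m generalizing s with
  | zero =>
    have : s = ∅ := by simpa using hs
    simp [this]
  | succ m ih =>
    rw [← Finset.sum_filter_add_sum_filter_not s (fun j => j < a + m * k)]
    push_cast
    have hs' : ∀ j ∈ s, a ≤ j ∧ j < a + m * k + k := fun j hj => by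
      have := Finset.mem_Ico.1 (hs hj)
      rw [Nat.succ_mul] at this
      omega
    refine add_le_add (ih fun j hj => ?_) (sum_blockInd_le_one (fun i hi j hj => ?_) π)
    · rw [Finset.mem_filter] at hj
      rw [Finset.mem_Ico]
      exact ⟨(hs' j hj.1).1, hj.2⟩
    · rw [Finset.mem_filter] at hi hj
      have := hs' i hi.1
      omega

lemma nbrSum_centredBlock (N : ℕ) (π : Equiv.Perm (Fin n)) :
    nbrSum (centredBlock n k) N k i π = ∑ j ∈ nbr N k i, blockInd n k j π
      - ∑ j ∈ nbr N k i, blockProb n k j := by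
  simp only [nbrSum, centredBlock, Finset.sum_sub_distrib]

lemma abs_nbrSum_le {N a m : ℕ} (h : nbr N k i ⊆ Finset.Ico a (a + m * k))
    (π : Equiv.Perm (Fin n)) : |nbrSum (centredBlock n k) N k i π| ≤ m := by
  have h1 := sum_blockInd_le (n := n) h
  have h2 : ∑ j ∈ nbr N k i, blockProb n k j ≤ m := by
    have := integral_mono (μ := unifB2 n) .of_finite (integrable_const (m : ℝ)) h1
    rw [integral_finsetSum _ fun _ _ => .of_finite] at this
    simpa [blockProb] using this
  have h3 : 0 ≤ ∑ j ∈ nbr N k i, blockProb n k j :=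
    Finset.sum_nonneg fun j _ => blockProb_nonneg n k j
  have h4 : 0 ≤ ∑ j ∈ nbr N k i, blockInd n k j π :=
    Finset.sum_nonneg fun j _ => blockInd_nonneg n k j π
  rw [nbrSum_centredBlock, abs_le]
  constructor <;> linarith [h1 π]

lemma integral_abs_mul_sq_le {S : Equiv.Perm (Fin n) → ℝ} {c : ℝ} (hS : ∀ π, |S π| ≤ c) :
    ∫ π, |centredBlock n k i π| * S π ^ 2 ∂(unifB2 n)
      ≤ 2 * (blockProb n k i * (1 - blockProb n k i)) * c ^ 2 := by
  rw [← integral_abs_centredBlock, ← integral_mul_const]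
  refine integral_mono .of_finite .of_finite fun π => ?_
  refine mul_le_mul_of_nonneg_left ?_ (abs_nonneg _)
  rw [← sq_abs]
  exact pow_le_pow_left₀ (abs_nonneg _) (hS π) 2

/-- For a Bernoulli variable `E |X| = 2 p (1 - p)` is at most `4 E |X|³`. -/
lemma integral_abs_mul_sq_le_of_abs_le {S : Equiv.Perm (Fin n) → ℝ} (hS : ∀ π, |S π| ≤ k) :
    ∫ π, |centredBlock n k i π| * S π ^ 2 ∂(unifB2 n)
      ≤ 4 * (k : ℝ) ^ 2 * ∫ π, |centredBlock n k i π| ^ 3 ∂(unifB2 n) := by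
  refine (integral_abs_mul_sq_le hS).trans ?_
  rw [integral_abs_centredBlock_pow_three]
  have h1 : 0 ≤ blockProb n k i * (1 - blockProb n k i) :=
    mul_nonneg (blockProb_nonneg n k i) (sub_nonneg.2 (blockProb_le_one n k i))
  have h2 : 0 ≤ (blockProb n k i * (1 - blockProb n k i)) * (k : ℝ) ^ 2 * 2 := by positivity
  nlinarith [mul_nonneg h2 (sq_nonneg (1 - 2 * blockProb n k i))]

/-- For `k = 2` three blocks fit into the neighbourhood of an interior index `i`. The neighbourhood
then has all of its five members, whose total probability is at least `5 / 8`. -/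
lemma integral_abs_mul_nbrSum_sq_le_two (hi : 2 ≤ i) (hin : i + 2 < n - 2 + 1) :
    ∫ π, |centredBlock n 2 i π| * nbrSum (centredBlock n 2) (n - 2 + 1) 2 i π ^ 2 ∂(unifB2 n)
      ≤ 4 * ((2 : ℕ) : ℝ) ^ 2 * ∫ π, |centredBlock n 2 i π| ^ 3 ∂(unifB2 n) := by
  have hnbr : nbr (n - 2 + 1) 2 i = Finset.Icc (i - 2) (i + 2) := by
    ext j; rw [mem_nbr, Finset.mem_Icc]; omega
  have hcard : (Finset.Icc (i - 2) (i + 2)).card = 5 := by rw [Nat.card_Icc]; omega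
  have hp : ∀ j ∈ Finset.Icc (i - 2) (i + 2),
      1 / 8 ≤ blockProb n 2 j ∧ blockProb n 2 j ≤ 1 / 4 := by
    intro j hj
    rw [Finset.mem_Icc] at hj
    rw [blockProb_eq_ite (by norm_num) (by omega) (by omega)]
    split_ifs <;> norm_num
  have hlow : 5 / 8 ≤ ∑ j ∈ nbr (n - 2 + 1) 2 i, blockProb n 2 j := by
    rw [hnbr]
    have := Finset.card_nsmul_le_sum _ _ _ fun j hj => (hp j hj).1
    rw [hcard] at this
    refine le_trans ?_ this
    norm_num
  have hupp : ∑ j ∈ nbr (n - 2 + 1) 2 i, blockProb n 2 j ≤ 5 / 4 := by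
    rw [hnbr]
    have := Finset.sum_le_card_nsmul _ _ _ fun j hj => (hp j hj).2
    rw [hcard] at this
    refine this.trans ?_
    norm_num
  have hS : ∀ π, |nbrSum (centredBlock n 2) (n - 2 + 1) 2 i π| ≤ 19 / 8 := by
    intro π
    have h1 : ∑ j ∈ nbr (n - 2 + 1) 2 i, blockInd n 2 j π ≤ (3 : ℕ) :=
      sum_blockInd_le (a := i - 2) (by
        intro j hj; rw [mem_nbr] at hj; rw [Finset.mem_Ico]; omega) π
    have h2 : 0 ≤ ∑ j ∈ nbr (n - 2 + 1) 2 i, blockInd n 2 j π :=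
      Finset.sum_nonneg fun j _ => blockInd_nonneg n 2 j π
    push_cast at h1
    rw [nbrSum_centredBlock, abs_le]
    constructor <;> linarith
  refine (integral_abs_mul_sq_le hS).trans ?_
  rw [integral_abs_centredBlock_pow_three, blockProb_eq_ite (by norm_num) (by omega) (by omega),
    if_neg (by omega)]
  norm_num

lemma integral_abs_mul_nbrSum_sq_le (hk : 2 ≤ k) (hkn : k ≤ n) (hi : i < n - k + 1) :
    ∫ π, |centredBlock n k i π| * nbrSum (centredBlock n k) (n - k + 1) k i π ^ 2 ∂(unifB2 n)
      ≤ 4 * (k : ℝ) ^ 2 * ∫ π, |centredBlock n k i π| ^ 3 ∂(unifB2 n) := by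
  rcases hk.eq_or_lt with rfl | hk
  · by_cases hint : 2 ≤ i ∧ i + 2 < n - 2 + 1
    · exact integral_abs_mul_nbrSum_sq_le_two hint.1 hint.2
    -- near an end only two blocks fit into the neighbourhood
    · refine integral_abs_mul_sq_le_of_abs_le fun π => ?_
      refine abs_nbrSum_le (a := i - 2) (m := 2) (fun j hj => ?_) π
      rw [mem_nbr] at hj
      rw [Finset.mem_Ico]
      omega
  · refine integral_abs_mul_sq_le_of_abs_le fun π => ?_
    have h3 : (3 : ℕ) ≤ (k : ℝ) := by exact_mod_cast hk
    refine (abs_nbrSum_le (a := i - k) (m := 3) (fun j hj => ?_) π).trans h3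
    rw [mem_nbr] at hj
    rw [Finset.mem_Ico]
    omega

end CubicTerm

section FixedPoints

variable {n : ℕ}

/-- The indicator of a cut at `j`. -/
noncomputable def cutInd (n j : ℕ) : Equiv.Perm (Fin n) → ℝ :=
  Set.indicator {π | IsCut π j} fun _ => 1

lemma cutInd_eq_zero_or_one (n j : ℕ) (π : Equiv.Perm (Fin n)) :
    cutInd n j π = 0 ∨ cutInd n j π = 1 := by
  by_cases h : IsCut π j <;> simp [cutInd, h]

lemma cutInd_zero (n : ℕ) (π : Equiv.Perm (Fin n)) : cutInd n 0 π = 1 := by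
  simp [cutInd, isCut_zero]

lemma cutInd_self (n : ℕ) (π : Equiv.Perm (Fin n)) : cutInd n n π = 1 := by
  simp [cutInd, isCut_of_le]

lemma integral_prod_cutInd (A : Finset ℕ) :
    ∫ π, ∏ j ∈ A, cutInd n j π ∂(unifB2 n) = ∏ j ∈ A, cutProb n j := by
  have h := integral_cuts (n := n) (A := A) (B := ∅) (by simp) (by simp)
  rw [Finset.card_empty, pow_zero, mul_one] at h
  rw [← h]
  refine integral_congr_ae (ae_of_all _ fun π => ?_)
  by_cases hA : ∀ j ∈ A, IsCut π j
  · simp only [cutInd, Set.indicator, Set.mem_ofPred_eq]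
    rw [Finset.prod_congr rfl fun j hj => if_pos (hA j hj)]
    simpa using hA
  · simp only [cutInd, Set.indicator, Set.mem_ofPred_eq]
    rw [if_neg fun h' => hA h'.1]
    push Not at hA
    obtain ⟨j, hj, hj'⟩ := hA
    exact Finset.prod_eq_zero hj (if_neg hj')

lemma integral_cutInd (a : ℕ) : ∫ π, cutInd n a π ∂(unifB2 n) = cutProb n a := by
  simpa using integral_prod_cutInd (n := n) {a}

lemma integral_cutInd_mul {a b : ℕ} (hab : a < b) :
    ∫ π, cutInd n a π * cutInd n b π ∂(unifB2 n) = cutProb n a * cutProb n b := by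
  have h := integral_prod_cutInd (n := n) {a, b}
  simpa only [Finset.prod_pair hab.ne] using h

lemma integral_cutInd_mul₃ {a b c : ℕ} (hab : a < b) (hbc : b < c) :
    ∫ π, cutInd n a π * cutInd n b π * cutInd n c π ∂(unifB2 n)
      = cutProb n a * cutProb n b * cutProb n c := by
  have h := integral_prod_cutInd (n := n) {a, b, c}
  have h1 : a ∉ ({b, c} : Finset ℕ) := by simp; omega
  simpa only [Finset.prod_insert h1, Finset.prod_pair hbc.ne, ← mul_assoc] using h

lemma integral_cutInd_mul₄ {a b c d : ℕ} (hab : a < b) (hbc : b < c) (hcd : c < d) :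
    ∫ π, cutInd n a π * cutInd n b π * cutInd n c π * cutInd n d π ∂(unifB2 n)
      = cutProb n a * cutProb n b * cutProb n c * cutProb n d := by
  have h := integral_prod_cutInd (n := n) {a, b, c, d}
  have h1 : a ∉ ({b, c, d} : Finset ℕ) := by simp; omega
  have h2 : b ∉ ({c, d} : Finset ℕ) := by simp; omega
  simpa only [Finset.prod_insert h1, Finset.prod_insert h2, Finset.prod_pair hcd.ne,
    ← mul_assoc] using h

lemma blockInd_one (n i : ℕ) (π : Equiv.Perm (Fin n)) :
    blockInd n 1 i π = cutInd n i π * cutInd n (i + 1) π := by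
  have h : IsBlock 1 i π ↔ IsCut π i ∧ IsCut π (i + 1) := by
    rw [isBlock_iff]
    refine ⟨fun h => ⟨h.1, h.2.1⟩, fun h => ⟨h.1, h.2, fun j h1 h2 => by omega⟩⟩
  by_cases h1 : IsCut π i <;> by_cases h2 : IsCut π (i + 1) <;>
    simp [blockInd, cutInd, h, h1, h2]

lemma blockProb_one {i : ℕ} (hi : i + 1 ≤ n) :
    blockProb n 1 i = cutProb n i * cutProb n (i + 1) := by
  rw [blockProb_eq le_rfl hi]; simp

lemma abs_centredBlock (n k i : ℕ) (π : Equiv.Perm (Fin n)) : |centredBlock n k i π|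
    = blockProb n k i + (1 - 2 * blockProb n k i) * blockInd n k i π := by
  have h0 := blockProb_nonneg n k i
  have h1 := blockProb_le_one n k i
  rw [centredBlock]
  rcases blockInd_eq_zero_or_one n k i π with h | h
  · rw [h, zero_sub, abs_neg, abs_of_nonneg h0]; ring
  · rw [h, abs_of_nonneg (by linarith)]; ring

/-- The value of `E |X i| S i²` for `k = 1` and `i = m + 1` away from the two ends, in terms of the
probabilities `ξ` and `η` of the two outer cuts, each of which is `1` or `1 / 2`. -/
lemma integral_abs_mul_nbrSum_sq_inner {m : ℕ} (hm : m + 2 < n) {ξ η : ℝ}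
    (hξ : cutProb n m = ξ) (hη : cutProb n (m + 3) = η) :
    ∫ π, |centredBlock n 1 (m + 1) π| * nbrSum (centredBlock n 1) n 1 (m + 1) π ^ 2 ∂(unifB2 n)
      = 1 / 4 * ((ξ + η + 1 / 4 + ξ * η / 2) - (ξ / 2 + 1 / 4 + η / 2) ^ 2)
        + 1 / 2 * ((1 / 4 + 3 * ξ / 4 + 3 * η / 4 + ξ * η / 2)
          - 2 * (ξ / 2 + 1 / 4 + η / 2) * (ξ / 4 + 1 / 4 + η / 4)
          + (ξ / 2 + 1 / 4 + η / 2) ^ 2 / 4) := by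
  have hy : cutProb n (m + 1) = 1 / 2 := cutProb_of_lt (by omega) (by omega)
  have hz : cutProb n (m + 2) = 1 / 2 := cutProb_of_lt (by omega) (by omega)
  have hp0 : blockProb n 1 m = ξ / 2 := by
    rw [blockProb_one (by omega), hξ, hy]; ring
  have hp1 : blockProb n 1 (m + 1) = 1 / 4 := by
    rw [blockProb_one (by omega), hy, hz]; norm_num
  have hp2 : blockProb n 1 (m + 2) = η / 2 := by
    rw [blockProb_one (by omega), hz, hη]; ring
  have hnbr : nbr n 1 (m + 1) = {m, m + 1, m + 2} := by
    ext j
    simp only [mem_nbr, Finset.mem_insert, Finset.mem_singleton]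
    omega
  set P : ℝ := ξ / 2 + 1 / 4 + η / 2 with hP
  have hexp : ∀ π : Equiv.Perm (Fin n),
      |centredBlock n 1 (m + 1) π| * nbrSum (centredBlock n 1) n 1 (m + 1) π ^ 2
      = (1 / 4 - P / 2) * (cutInd n m π * cutInd n (m + 1) π)
        + (1 / 4 - P / 2) * (cutInd n (m + 2) π * cutInd n (m + 3) π)
        + (3 / 4 - 3 * P / 2 + P ^ 2 / 2) * (cutInd n (m + 1) π * cutInd n (m + 2) π)
        + (2 - P) * (cutInd n m π * cutInd n (m + 1) π * cutInd n (m + 2) π)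
        + (2 - P) * (cutInd n (m + 1) π * cutInd n (m + 2) π * cutInd n (m + 3) π)
        + 3 / 2 * (cutInd n m π * cutInd n (m + 1) π * cutInd n (m + 2) π * cutInd n (m + 3) π)
        + P ^ 2 / 4 := by
    intro π
    have hx01 := cutInd_eq_zero_or_one n m π
    have hy01 := cutInd_eq_zero_or_one n (m + 1) π
    have hz01 := cutInd_eq_zero_or_one n (m + 2) π
    have hw01 := cutInd_eq_zero_or_one n (m + 3) π
    rw [nbrSum_centredBlock, abs_centredBlock, hnbr,
      Finset.sum_insert (by simp), Finset.sum_pair (by simp),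
      Finset.sum_insert (by simp), Finset.sum_pair (by simp), hp0, hp1, hp2,
      blockInd_one, blockInd_one, blockInd_one]
    rw [show ξ / 2 + (1 / 4 + η / 2) = P by rw [hP]; ring]
    generalize cutInd n m π = x at *
    generalize cutInd n (m + 1) π = y at *
    generalize cutInd n (m + 2) π = z at *
    generalize cutInd n (m + 3) π = w at *
    rcases hx01 with rfl | rfl <;> rcases hy01 with rfl | rfl <;> rcases hz01 with rfl | rfl <;>
      rcases hw01 with rfl | rfl <;> ring
  simp_rw [hexp]
  repeat rw [integral_add .of_finite .of_finite]
  simp only [integral_const_mul]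
  rw [integral_cutInd_mul (by omega), integral_cutInd_mul (by omega),
    integral_cutInd_mul (by omega), integral_cutInd_mul₃ (by omega) (by omega),
    integral_cutInd_mul₃ (by omega) (by omega),
    integral_cutInd_mul₄ (by omega) (by omega) (by omega), hξ, hη, hy, hz]
  simp
  ring

/-- The value of `E |X i| S i²` for `k = 1` at an end, where `ξ` is the probability of the cut
at distance two from the end. -/
lemma integral_abs_mul_nbrSum_sq_left (hn : 2 ≤ n) {ξ : ℝ} (hξ : cutProb n 2 = ξ) :
    ∫ π, |centredBlock n 1 0 π| * nbrSum (centredBlock n 1) n 1 0 π ^ 2 ∂(unifB2 n)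
      = 1 / 2 * ((1 / 2 + 3 * ξ / 2) - (1 / 2 + ξ / 2) ^ 2) := by
  have hy : cutProb n 1 = 1 / 2 := cutProb_of_lt (by omega) (by omega)
  have hp0 : blockProb n 1 0 = 1 / 2 := by
    rw [blockProb_one (by omega), cutProb_zero, hy]; ring
  have hp1 : blockProb n 1 1 = ξ / 2 := by
    rw [blockProb_one (by omega), hy, hξ]; ring
  have hnbr : nbr n 1 0 = {0, 1} := by
    ext j
    simp only [mem_nbr, Finset.mem_insert, Finset.mem_singleton]
    omega
  have hexp : ∀ π : Equiv.Perm (Fin n),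
      |centredBlock n 1 0 π| * nbrSum (centredBlock n 1) n 1 0 π ^ 2
      = -(ξ / 2) * cutInd n 1 π + (1 - ξ / 2) * (cutInd n 1 π * cutInd n 2 π)
        + (1 + ξ) ^ 2 / 8 := by
    intro π
    have hy01 := cutInd_eq_zero_or_one n 1 π
    have hz01 := cutInd_eq_zero_or_one n 2 π
    rw [nbrSum_centredBlock, abs_centredBlock, hnbr, Finset.sum_pair (by simp),
      Finset.sum_pair (by simp), hp0, hp1, blockInd_one, blockInd_one, cutInd_zero]
    simp only [zero_add, Nat.reduceAdd]
    generalize cutInd n 1 π = y at *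
    generalize cutInd n 2 π = z at *
    rcases hy01 with rfl | rfl <;> rcases hz01 with rfl | rfl <;> ring
  simp_rw [hexp]
  repeat rw [integral_add .of_finite .of_finite]
  simp only [integral_const_mul]
  rw [integral_cutInd_mul (by omega), integral_cutInd, hξ, hy]
  simp
  ring

lemma integral_abs_mul_nbrSum_sq_right {m : ℕ} {ξ : ℝ} (hξ : cutProb (m + 2) m = ξ) :
    ∫ π, |centredBlock (m + 2) 1 (m + 1) π| *
      nbrSum (centredBlock (m + 2) 1) (m + 2) 1 (m + 1) π ^ 2 ∂(unifB2 (m + 2))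
      = 1 / 2 * ((1 / 2 + 3 * ξ / 2) - (1 / 2 + ξ / 2) ^ 2) := by
  have hy : cutProb (m + 2) (m + 1) = 1 / 2 := cutProb_of_lt (by omega) (by omega)
  have hp0 : blockProb (m + 2) 1 (m + 1) = 1 / 2 := by
    rw [blockProb_one (by omega), cutProb_self, hy]; ring
  have hp1 : blockProb (m + 2) 1 m = ξ / 2 := by
    rw [blockProb_one (by omega), hy, hξ]; ring
  have hnbr : nbr (m + 2) 1 (m + 1) = {m, m + 1} := by
    ext j
    simp only [mem_nbr, Finset.mem_insert, Finset.mem_singleton]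
    omega
  have hexp : ∀ π : Equiv.Perm (Fin (m + 2)),
      |centredBlock (m + 2) 1 (m + 1) π| *
        nbrSum (centredBlock (m + 2) 1) (m + 2) 1 (m + 1) π ^ 2
      = -(ξ / 2) * cutInd (m + 2) (m + 1) π
        + (1 - ξ / 2) * (cutInd (m + 2) m π * cutInd (m + 2) (m + 1) π)
        + (1 + ξ) ^ 2 / 8 := by
    intro π
    have hy01 := cutInd_eq_zero_or_one (m + 2) (m + 1) π
    have hz01 := cutInd_eq_zero_or_one (m + 2) m π
    rw [nbrSum_centredBlock, abs_centredBlock, hnbr, Finset.sum_pair (by simp),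
      Finset.sum_pair (by simp), hp0, hp1, blockInd_one, blockInd_one, cutInd_self]
    generalize cutInd (m + 2) (m + 1) π = y at *
    generalize cutInd (m + 2) m π = z at *
    rcases hy01 with rfl | rfl <;> rcases hz01 with rfl | rfl <;> ring
  simp_rw [hexp]
  repeat rw [integral_add .of_finite .of_finite]
  simp only [integral_const_mul]
  rw [integral_cutInd_mul (by omega), integral_cutInd, hξ, hy]
  simp
  ring

lemma sum_integral_abs_mul_nbrSum_sq_le_one (hn : 2 ≤ n) :
    ∑ i ∈ Finset.range n,
      ∫ π, |centredBlock n 1 i π| * nbrSum (centredBlock n 1) n 1 i π ^ 2 ∂(unifB2 n)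
      ≤ 4 * aSum n 1 := by
  rw [aSum_formula le_rfl (by omega)]
  obtain ⟨m, rfl⟩ := Nat.exists_eq_add_of_le' hn
  rw [Finset.sum_range_succ, Finset.sum_range_succ']
  -- the cases `n = 2`, `n = 3` and `n ≥ 4`: the values at the outer two indices on each side differ
  -- from the common value `59 / 128` in the middle
  rcases Nat.eq_zero_or_pos m with rfl | hm0
  · rw [integral_abs_mul_nbrSum_sq_left le_rfl (cutProb_self 2),
      integral_abs_mul_nbrSum_sq_right (cutProb_zero _)]
    norm_num
  rw [integral_abs_mul_nbrSum_sq_left hn (cutProb_of_lt (by norm_num) (by omega)),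
    integral_abs_mul_nbrSum_sq_right (cutProb_of_lt hm0 (by omega))]
  obtain ⟨l, rfl⟩ := Nat.exists_eq_add_of_le' (show 1 ≤ m from hm0)
  rw [Finset.sum_range_succ]
  rcases Nat.eq_zero_or_pos l with rfl | hl0
  · rw [integral_abs_mul_nbrSum_sq_inner (by omega) (cutProb_zero _) (cutProb_self _)]
    norm_num
  obtain ⟨r, rfl⟩ := Nat.exists_eq_add_of_le' (show 1 ≤ l from hl0)
  have hmid : ∀ j ∈ Finset.range r, ∫ π, |centredBlock (r + 1 + 1 + 2) 1 (j + 1 + 1) π| *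
      nbrSum (centredBlock (r + 1 + 1 + 2) 1) (r + 1 + 1 + 2) 1 (j + 1 + 1) π ^ 2
        ∂(unifB2 (r + 1 + 1 + 2)) = 59 / 128 := by
    intro j hj
    rw [Finset.mem_range] at hj
    rw [integral_abs_mul_nbrSum_sq_inner (m := j + 1) (by omega)
      (cutProb_of_lt (by omega) (by omega)) (cutProb_of_lt (by omega) (by omega))]
    norm_num
  rw [Finset.sum_range_succ', Finset.sum_congr rfl hmid, Finset.sum_const, Finset.card_range,
    nsmul_eq_mul, integral_abs_mul_nbrSum_sq_inner (by omega) (cutProb_zero _)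
      (cutProb_of_lt (by omega) (by omega)),
    integral_abs_mul_nbrSum_sq_inner (by omega) (cutProb_of_lt (by omega) (by omega))
      (cutProb_self _)]
  push_cast
  norm_num
  have : (0 : ℝ) ≤ r := Nat.cast_nonneg r
  linarith

end FixedPoints

/-- The first error term of the local dependence bound is at most the one with `(2 k)²` in place of
the squared size `(2 k + 1)²` of the neighbourhoods, because at most three `k`-cycles can occur in
a neighbourhood. -/
lemma sum_integral_abs_mul_nbrSum_sq_le {n k : ℕ} (hk : 1 ≤ k) (hn : 2 ≤ n) (hkn : k ≤ n) :
    ∑ i ∈ Finset.range (n - k + 1),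
      ∫ π, |centredBlock n k i π| * nbrSum (centredBlock n k) (n - k + 1) k i π ^ 2 ∂(unifB2 n)
      ≤ 4 * (k : ℝ) ^ 2 * aSum n k := by
  rcases hk.eq_or_lt with rfl | hk
  · rw [Nat.sub_add_cancel hkn]
    simpa using sum_integral_abs_mul_nbrSum_sq_le_one hn
  · rw [aSum_eq hk.le hkn, Finset.mul_sum]
    refine Finset.sum_le_sum fun i hi => ?_
    exact integral_abs_mul_nbrSum_sq_le hk hkn (Finset.mem_range.1 hi)

/-! ### The Wasserstein bound and the asymptotics -/

section Bound

variable {n k : ℕ}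

lemma sigma_pos (hk : 1 ≤ k) (hn : 2 ≤ n) (hkn : k ≤ n) : 0 < sigma n k :=
  Real.sqrt_pos.2 (sigmaSq_pos hk hn hkn)

lemma sq_sigma (n k : ℕ) : sigma n k ^ 2 = sigmaSq n k := Real.sq_sqrt (variance_nonneg _ _)

/-- The second error term: the true numbers `6 k + 1` and `2 k + 1` of dependent indices are covered
by the constant `28 / π`, because the derivative of the Stein solution is bounded by `1`. -/
lemma sqrt_dependence_le (hk : 1 ≤ k) {b : ℝ} (hb : 0 ≤ b) :
    √((6 * k + 1) * ((2 * k + 1) ^ 2 * b))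
      ≤ √28 * (2 * (k : ℝ)) ^ ((3 : ℝ) / 2) / √Real.pi * √b := by
  have h1 : (2 * (k : ℝ)) ^ ((3 : ℝ) / 2) = √((2 * (k : ℝ)) ^ 3) := by
    rw [Real.sqrt_eq_rpow, ← Real.rpow_natCast, ← Real.rpow_mul (by positivity)]
    norm_num
  rw [h1, ← Real.sqrt_mul (by norm_num), ← Real.sqrt_div' _ Real.pi_pos.le,
    ← Real.sqrt_mul (by positivity), ← mul_assoc]
  refine Real.sqrt_le_sqrt (mul_le_mul_of_nonneg_right ?_ hb)
  rw [le_div_iff₀ Real.pi_pos]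
  have hk' : (1 : ℝ) ≤ k := by exact_mod_cast hk
  calc ((6 * (k : ℝ) + 1) * (2 * k + 1) ^ 2) * Real.pi
      ≤ (7 * (k : ℝ) * (3 * k) ^ 2) * 3.15 := by
        have := Real.pi_lt_d2.le
        gcongr <;> linarith
    _ ≤ 28 * (2 * (k : ℝ)) ^ 3 := by
        have : (0 : ℝ) ≤ (k : ℝ) ^ 3 := by positivity
        nlinarith

lemma integral_map_W (hk : 1 ≤ k) (hkn : k ≤ n) {h : ℝ → ℝ} (hc : Continuous h) :
    ∫ x, h x ∂((unifB2 n).map (W n k)) = ∫ π, h (1 / sigma n k *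
      ∑ i ∈ Finset.range (n - k + 1), centredBlock n k i π) ∂(unifB2 n) := by
  rw [integral_map Measurable.of_discrete.aemeasurable hc.aestronglyMeasurable]
  refine integral_congr_ae ?_
  filter_upwards [ae_isBRegular n] with π hπ
  rw [W, Finset.sum_congr rfl fun i hi => X_eq_centredBlock hπ hk (by
    rw [Finset.mem_range] at hi; omega)]

theorem wassersteinDist_le_upperBound (hk : 1 ≤ k) (hn : 2 ≤ n) (hkn : k ≤ n) :
    wassersteinDist ((unifB2 n).map (W n k)) (gaussianReal 0 1)
      ≤ ENNReal.ofReal (upperBound n k) := by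
  refine iSup₂_le fun h hh => ENNReal.ofReal_le_ofReal ?_
  have hc : Continuous h := by
    refine (LipschitzWith.of_dist_le_mul (K := 1) fun x y => ?_).continuous
    simpa [Real.dist_eq] using hh x y
  have hσ := sigma_pos hk hn hkn
  rw [integral_map_W hk hkn hc]
  refine (stein_local_dependence hσ (fun i _ => integral_centredBlock n k i)
    (by rw [sq_sigma, sigmaSq_eq hk hkn]) (fun i hi => indepFun_centredBlock_sum hkn hi)
    (fun i j _ _ hij => indepFun_mul_nbrSum _ hij) hh).trans ?_
  rw [upperBound]
  refine add_le_add ?_ ?_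
  · calc _ ≤ 1 / sigma n k ^ 3 * (4 * (k : ℝ) ^ 2 * aSum n k) :=
          mul_le_mul_of_nonneg_left (sum_integral_abs_mul_nbrSum_sq_le hk hn hkn) (by positivity)
      _ = _ := by ring
  · have hb : 0 ≤ bSum n k := Finset.sum_nonneg fun i _ => integral_nonneg fun π => by positivity
    calc _ ≤ 1 / sigma n k ^ 2 * √((6 * k + 1) * ((2 * k + 1) ^ 2 * bSum n k)) := by
          rw [bSum_eq hk hkn]
          refine mul_le_mul_of_nonneg_left (Real.sqrt_le_sqrt ?_) (by positivity)
          exact mul_le_mul_of_nonneg_left (sum_integral_sq_mul_nbrSum_le _ _ _) (by positivity)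
      _ ≤ 1 / sigma n k ^ 2 * (√28 * (2 * (k : ℝ)) ^ ((3 : ℝ) / 2) / √Real.pi * √(bSum n k)) :=
          mul_le_mul_of_nonneg_left (sqrt_dependence_le hk hb) (by positivity)
      _ = _ := by ring

end Bound

section Asymptotic

lemma tendsto_div_of_eventually_eq_affine {f : ℕ → ℝ} {c d : ℝ}
    (h : ∀ᶠ n : ℕ in atTop, f n = c * n + d) :
    Tendsto (fun n : ℕ => f n / n) atTop (nhds c) := by
  have h1 : Tendsto (fun n : ℕ => c + d / n) atTop (nhds (c + 0)) :=
    (tendsto_const_div_atTop_nhds_zero_nat d).const_add c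
  rw [add_zero] at h1
  refine h1.congr' ?_
  filter_upwards [h, eventually_gt_atTop 0] with n hn hpos
  have : (n : ℝ) ≠ 0 := by positivity
  rw [hn]
  field_simp

lemma isTheta_natCast_of_tendsto_div {f : ℕ → ℝ} {c : ℝ} (hc : c ≠ 0)
    (h : Tendsto (fun n : ℕ => f n / n) atTop (nhds c)) :
    f =Θ[atTop] (fun n : ℕ => (n : ℝ)) :=
  (isTheta_of_div_tendsto_nhds_ne_zero h hc).symm

variable (k : ℕ)

lemma exists_tendsto_sigmaSq_div (hk : 1 ≤ k) :
    ∃ c : ℝ, 0 < c ∧ Tendsto (fun n : ℕ => sigmaSq n k / n) atTop (nhds c) := by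
  refine ⟨((2 : ℝ) ^ (k + 1) - 2 * k + 3) / 4 ^ (k + 1), ?_,
    tendsto_div_of_eventually_eq_affine
      (d := (3 * k * ((k : ℝ) - 4) + (3 - (k : ℝ)) * 2 ^ (k + 1) + 5) / 4 ^ (k + 1)) ?_⟩
  · have h : ((k : ℝ) + 1) ≤ 2 ^ k := by exact_mod_cast Nat.lt_two_pow_self
    have : 0 < (2 : ℝ) ^ (k + 1) - 2 * k + 3 := by rw [pow_succ]; linarith
    positivity
  · filter_upwards [eventually_gt_atTop (2 * k)] with n hn
    rw [sigmaSq_formula hk hn]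
    ring

lemma exists_tendsto_aSum_div (hk : 1 ≤ k) :
    ∃ c : ℝ, 0 < c ∧ Tendsto (fun n : ℕ => aSum n k / n) atTop (nhds c) := by
  set G := ((2 : ℝ) ^ (3 * (k + 1)) - 3 * 2 ^ (2 * (k + 1)) + 2 ^ (k + 3) - 2) / 2 ^ (4 * (k + 1))
    with hG
  refine ⟨G, ?_, tendsto_div_of_eventually_eq_affine
      (d := 2 * (((2 : ℝ) ^ (3 * k) - 3 * 2 ^ (2 * k) + 2 ^ (k + 2) - 2) / 2 ^ (4 * k))
        - (k + 1) * G) ?_⟩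
  · have h : (1 : ℝ) < 2 ^ (k + 1) := one_lt_pow₀ (by norm_num) (by omega)
    have h1 : (2 : ℝ) ^ (3 * (k + 1)) - 3 * 2 ^ (2 * (k + 1)) + 2 ^ (k + 3) - 2
        = (2 ^ (k + 1) - 1) * ((2 ^ (k + 1) - 1) ^ 2 + 1) := by
      rw [mul_comm 3 (k + 1), mul_comm 2 (k + 1), pow_mul, pow_mul, show k + 3 = k + 1 + 2 by rfl,
        pow_add 2 (k + 1) 2]
      ring
    have h2 : (0 : ℝ) < 2 ^ (k + 1) - 1 := by linarith
    rw [hG, h1]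
    positivity
  · filter_upwards [eventually_gt_atTop k] with n hn
    rw [aSum_formula hk hn]
    ring

lemma exists_tendsto_bSum_div (hk : 1 ≤ k) :
    ∃ c : ℝ, 0 < c ∧ Tendsto (fun n : ℕ => bSum n k / n) atTop (nhds c) := by
  set G := ((2 : ℝ) ^ (2 * (k + 1)) - 3 * 2 ^ (k + 1) + 3) * (2 ^ (k + 1) - 1) / 2 ^ (4 * (k + 1))
    with hG
  refine ⟨G, ?_, tendsto_div_of_eventually_eq_affine
      (d := 2 * (((2 : ℝ) ^ (2 * k) - 3 * 2 ^ k + 3) * (2 ^ k - 1) / 2 ^ (4 * k))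
        - (k + 1) * G) ?_⟩
  · have h : (1 : ℝ) < 2 ^ (k + 1) := one_lt_pow₀ (by norm_num) (by omega)
    have h1 : (2 : ℝ) ^ (2 * (k + 1)) - 3 * 2 ^ (k + 1) + 3
        = (2 ^ (k + 1) - 3 / 2) ^ 2 + 3 / 4 := by
      rw [mul_comm 2 (k + 1), pow_mul]
      ring
    have h2 : (0 : ℝ) < 2 ^ (k + 1) - 1 := by linarith
    rw [hG, h1]
    positivity
  · filter_upwards [eventually_gt_atTop k] with n hn
    rw [bSum_formula hk hn]
    ring

lemma upperBound_isTheta (hk : 1 ≤ k) :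
    (fun n : ℕ => upperBound n k) =Θ[atTop] (fun n : ℕ => (n : ℝ) ^ (-(1 : ℝ) / 2)) := by
  obtain ⟨s, hs, hs'⟩ := exists_tendsto_sigmaSq_div k hk
  obtain ⟨α, hα, hα'⟩ := exists_tendsto_aSum_div k hk
  obtain ⟨β, hβ, hβ'⟩ := exists_tendsto_bSum_div k hk
  have hkpos : (0 : ℝ) < k := by exact_mod_cast hk
  set c : ℝ := √28 * (2 * (k : ℝ)) ^ ((3 : ℝ) / 2) / √Real.pi with hc
  have hc0 : 0 < c := by positivity
  have hlim : Tendsto (fun n : ℕ => 4 * (k : ℝ) ^ 2 * (aSum n k / n) / √(sigmaSq n k / n) ^ 3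
      + c * √(bSum n k / n) / (sigmaSq n k / n)) atTop
      (nhds (4 * (k : ℝ) ^ 2 * α / √s ^ 3 + c * √β / s)) :=
    ((hα'.const_mul _).div (hs'.sqrt.pow 3) (by positivity)).add
      ((hβ'.sqrt.const_mul c).div hs' hs.ne')
  refine (isTheta_of_div_tendsto_nhds_ne_zero
    (c := 4 * (k : ℝ) ^ 2 * α / √s ^ 3 + c * √β / s) (hlim.congr' ?_) (by positivity)).symm
  filter_upwards [eventually_ge_atTop 2, eventually_ge_atTop k] with n hn hkn
  have hn0 : (0 : ℝ) < n := by positivity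
  have hσ := sigma_pos hk hn hkn
  have hr : (n : ℝ) ^ (-(1 : ℝ) / 2) = 1 / √n := by
    rw [neg_div, Real.rpow_neg hn0.le, ← Real.sqrt_eq_rpow, one_div]
  have hsn : 0 < √(n : ℝ) := Real.sqrt_pos.2 hn0
  have hsq : √(n : ℝ) ^ 2 = n := Real.sq_sqrt hn0.le
  rw [hr, upperBound, Real.sqrt_div' _ hn0.le, Real.sqrt_div' _ hn0.le, ← sq_sigma,
    Real.sqrt_sq hσ.le, ← hsq, Real.sqrt_sq hsn.le, hc]
  field_simp

end Asymptotic

theorem mainTheorem2 (k : ℕ) (hk : 1 ≤ k) :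
    -- the bound
    (∀ n : ℕ, 2 ≤ n → k ≤ n →
      0 < sigma n k ∧
      wassersteinDist ((unifB2 n).map (W n k)) (gaussianReal 0 1)
        ≤ ENNReal.ofReal (upperBound n k)) ∧
    -- the explicit values of the shifts and of the third and fourth moment sums
    (∀ n : ℕ, k < n →
      (∀ i ∈ Finset.range (n - k + 1), ∫ π, cycInd n k i π ∂(unifB2 n)
        = if i = 0 ∨ i = n - k then 1 / 2 ^ k else 1 / 2 ^ (k + 1)) ∧
      aSum n k
        = 2 * (((2 : ℝ) ^ (3 * k) - 3 * 2 ^ (2 * k) + 2 ^ (k + 2) - 2) / 2 ^ (4 * k))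
          + ((n : ℝ) - k - 1) *
            (((2 : ℝ) ^ (3 * (k + 1)) - 3 * 2 ^ (2 * (k + 1)) + 2 ^ (k + 3) - 2)
              / 2 ^ (4 * (k + 1))) ∧
      bSum n k
        = 2 * (((2 : ℝ) ^ (2 * k) - 3 * 2 ^ k + 3) * (2 ^ k - 1) / 2 ^ (4 * k))
          + ((n : ℝ) - k - 1) *
            (((2 : ℝ) ^ (2 * (k + 1)) - 3 * 2 ^ (k + 1) + 3) * (2 ^ (k + 1) - 1)
              / 2 ^ (4 * (k + 1)))) ∧
    -- the explicit value of the variance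
    (∀ n : ℕ, 2 * k < n →
      sigmaSq n k
        = (((2 : ℝ) ^ (k + 1) - 2 * k + 3) * n + 3 * k * ((k : ℝ) - 4)
            + (3 - (k : ℝ)) * 2 ^ (k + 1) + 5) / 4 ^ (k + 1)) ∧
    -- the orders of magnitude, for fixed `k`
    (fun n : ℕ => sigmaSq n k) =Θ[atTop] (fun n : ℕ => (n : ℝ)) ∧
    (fun n : ℕ => aSum n k) =Θ[atTop] (fun n : ℕ => (n : ℝ)) ∧
    (fun n : ℕ => bSum n k) =Θ[atTop] (fun n : ℕ => (n : ℝ)) ∧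
    (fun n : ℕ => upperBound n k) =Θ[atTop] (fun n : ℕ => (n : ℝ) ^ (-(1 : ℝ) / 2)) := by
  obtain ⟨s, hs, hs'⟩ := exists_tendsto_sigmaSq_div k hk
  obtain ⟨α, hα, hα'⟩ := exists_tendsto_aSum_div k hk
  obtain ⟨β, hβ, hβ'⟩ := exists_tendsto_bSum_div k hk
  refine ⟨fun n hn hkn => ⟨sigma_pos hk hn hkn, wassersteinDist_le_upperBound hk hn hkn⟩,
    fun n hkn => ⟨fun i hi => ?_, aSum_formula hk hkn, bSum_formula hk hkn⟩,
    fun n hkn => sigmaSq_formula hk hkn, isTheta_natCast_of_tendsto_div hs.ne' hs',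
    isTheta_natCast_of_tendsto_div hα.ne' hα', isTheta_natCast_of_tendsto_div hβ.ne' hβ',
    upperBound_isTheta k hk⟩
  rw [Finset.mem_range] at hi
  rw [integral_cycInd hk (by omega), blockProb_eq_ite hk hkn (by omega)]
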